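/- Let $0<b\le\infty$ and let $R_1,R_2:[0,b)\to\mathbb R$ be non-decreasing, left-continuous, with $R_1(0)=R_2(0)=0$; let $dR_i$ be the Lebesgue–Stieltjes measure on $[0,b)$ with $dR_i([0,x))=R_i(x)$. Put $R_i(b)=\lim_{x\to b}R_i(x)$, and for $x\in[0,b)$ let $\int_0^x$ denote integration over $[0,x)$. Assume that $R_1$ and $R_2$ have no common point of discontinuity, and that for some $[0,b_0)\subseteq[0,b)$ the classes of $1$ and $R_1$ in $L^2(dR_2,[0,b_0))$ are linearly independent. The integral system $S[R_1,R_2]$ with parameter $\lambda\in\mathbb C$ is $$u_1(x)=u_1(0)+\int_0^x u_2\,dR_1,\qquad u_2(x)=u_2(0)-\lambda\int_0^x u_1\,dR_2,\qquad x\in[0,b).$$ Let $c=(c_1,c_2)^T$, $s=(s_1,s_2)^T$ be its (unique) solutions with $c(0)=(1,0)^T$, $s(0)=(0,1)^T$, and let $U(x,\lambda)=\begin{pmatrix}c_1&s_1\\c_2&s_2\end{pmatrix}$ be the fundamental matrix. The system is regular if $R_1(b)+R_2(b)<\infty$, and singular otherwise; in the regular case we take $b<\infty$ (without loss of generality, by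 a change of the variable $x$). The dual system $\hat S$ is $S[R_2,R_1]$ on $[0,b)$ if $S[R_1,R_2]$ is singular. If $S[R_1,R_2]$ is regular, then $\hat S=S[\tilde R_2,\tilde R_1]$ on $[0,\infty)$, where $\tilde R_i=R_i$ on $[0,b)$ and $\tilde R_1(x)=R_1(b)$, $\tilde R_2(x)=R_2(b)+x-b$ for $x\ge b$. Objects belonging to $\hat S$ carry a hat. A system $S[R_1,R_2]$ is in the limit point (limit circle) case at $b$ if for every $\lambda\in\mathbb C\setminus\mathbb R$ the space of its solutions with $\int_{[0,b)}|u_1|^2dR_2<\infty$ has dimension $1$ (respectively $2$). The Neumann $m$-function $m_N(\lambda)$ is the unique number such that $s_1-m_N(\lambda)c_1\in\mathcal L^2(dR_2)$ in the limit point case, and such that $s_2(x,\lambda)-m_N(\lambda)c_2(x,\lambda)\to0$ as $x\to b$ in the limit circle case. For regular systems, $m_{ND}(\lambda)$ is the unique number with $s_1(x,\lambda)-m_{ND}(\lambda)c_1(x,\lambda)\to0$ as $x\to b$. The principal Titchmarsh–Weyl coefficient is $q(\lambda)=\lim_{x\to b}s_1(x,\lambda)/c_1(x,\lambda)$. For $\hat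 S$ the same definitions are used, with the right endpoint and the two functions of $\hat S$. Then: (i) for all $\lambda\neq0$ and $x\in[0,b)$, $\hat U(x,\lambda)=D(\lambda)^{-1}U(x,\lambda)D(\lambda)$ with $D(\lambda)=\begin{pmatrix}0&-1/\lambda\\1&0\end{pmatrix}$; in the regular case this also holds for all $x\in[0,\infty)$ with $U$ replaced by the fundamental matrix of $S[\tilde R_1,\tilde R_2]$; (ii) if $S[R_1,R_2]$ is singular then for $\lambda\in\mathbb C\setminus\mathbb R$ the values $m_N(\lambda)$, $\hat m_N(\lambda)$ are well defined, $m_N(\lambda)\ne0$, and $\hat m_N(\lambda)=-\dfrac1{\lambda m_N(\lambda)}$; (iii) if $S[R_1,R_2]$ is regular then for $\lambda\in\mathbb C\setminus[0,\infty)$ the limits $c_1(b,\lambda)$, $s_1(b,\lambda)$ of $c_1,s_1$ at $b$ exist, $\hat m_N(\lambda)$ and $m_{ND}(\lambda)$ are well defined, and $\hat m_N(\lambda)=\dfrac{\hat s_2(b,\lambda)}{\hat c_2(b,\lambda)}=-\dfrac{c_1(b,\lambda)}{\lambda s_1(b,\lambda)}=-\dfrac1{\lambda m_{ND}(\lambda)}$,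 all denominators being nonzero; (iv) for $\lambda\in\mathbb C\setminus[0,\infty)$ the coefficients $q(\lambda)$, $\hat q(\lambda)$ exist, $q(\lambda)\ne0$, and $\hat q(\lambda)=-\dfrac1{\lambda q(\lambda)}$. -/

import Mathlib

open MeasureTheory Set Filter Topology

noncomputable section

namespace IntSys

/-- The interval `[0, b)` of the real line, where `0 < b ≤ ∞`. -/
def interval (b : EReal) : Set ℝ := {x | 0 ≤ x ∧ (x : EReal) < b}

/-- The filter on `ℝ` describing `x → b`, `x < b` (it is `atTop` for `b = ∞`). -/
def endFilter (b : EReal) : Filter ℝ := comap ((↑) : ℝ → EReal) (𝓝[<] b)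

/-- A non-decreasing left-continuous real function on `[0, b)` that vanishes at `0`.
The values outside `[0, b)` are irrelevant. -/
structure DistFun (b : EReal) where
  toFun : ℝ → ℝ
  mono : MonotoneOn toFun (interval b)
  leftCont : ∀ x ∈ interval b, ContinuousWithinAt toFun (Ico 0 x) x
  zero : toFun 0 = 0

instance (b : EReal) : CoeFun (DistFun b) (fun _ => ℝ → ℝ) := ⟨DistFun.toFun⟩

namespace DistFun

variable {b : EReal} (R : DistFun b)

/-- `R` frozen to the left of `0` and to the right of `y`. -/
def trunc (y : ℝ) : ℝ → ℝ := fun t => R (max 0 (min t y))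

theorem trunc_mono (y : interval b) : Monotone (R.trunc y) := by
  have key : ∀ u : ℝ, max 0 (min u (y : ℝ)) ∈ interval b := fun u =>
    ⟨le_max_left _ _, lt_of_le_of_lt
      (EReal.coe_le_coe_iff.2 (max_le y.2.1 (min_le_right u (y : ℝ)))) y.2.2⟩
  intro s t hst
  exact R.mono (key s) (key t) (max_le_max le_rfl (min_le_min hst le_rfl))

/-- The Lebesgue–Stieltjes measure `dR` of a left-continuous non-decreasing function `R` on `[0, b)`.
It is carried by `[0, b)` and satisfies `dR [0, x) = R x`, see the two lemmas below.  For every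
`y < b` the measure of the truncated function is the restriction of `dR` to `[0, y)`. -/
def measure : Measure ℝ := ⨆ y : interval b, (R.trunc_mono y).stieltjesFunction.measure

theorem trunc_leftLim (y : interval b) (x : ℝ) :
    Function.leftLim (R.trunc y) x = R.trunc y x := by
  rw [← (R.trunc_mono y).continuousWithinAt_Iio_iff_leftLim_eq]
  rcases le_or_gt x 0 with h | h
  · refine (continuousWithinAt_const (b := R 0)).congr (fun t ht => ?_) ?_
    · have : min t (y : ℝ) ≤ 0 := (min_le_left _ _).trans (le_of_lt (lt_of_lt_of_le ht h))
      simp [trunc, max_eq_left this]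
    · have : min x (y : ℝ) ≤ 0 := (min_le_left _ _).trans h
      simp [trunc, max_eq_left this]
  · rcases lt_or_ge (y : ℝ) x with h' | h'
    · refine (continuousWithinAt_const (b := R y)).congr_of_eventuallyEq ?_ ?_
      · have : ∀ᶠ t in 𝓝[<] x, (y : ℝ) < t := (lt_mem_nhds h').filter_mono nhdsWithin_le_nhds
        filter_upwards [this] with t ht
        simp [trunc, min_eq_right ht.le, max_eq_right y.2.1]
      · simp [trunc, min_eq_right h'.le, max_eq_right y.2.1]
    · have hx : x ∈ interval b :=
        ⟨h.le, lt_of_le_of_lt (EReal.coe_le_coe_iff.2 h') y.2.2⟩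
      have hc : ContinuousWithinAt R (Iio x) x := by
        have := R.leftCont x hx
        rw [ContinuousWithinAt] at this ⊢
        rwa [nhdsWithin_Ico_eq_nhdsLT h] at this
      refine hc.congr_of_eventuallyEq ?_ ?_
      · have : ∀ᶠ t in 𝓝[<] x, 0 < t := (lt_mem_nhds h).filter_mono nhdsWithin_le_nhds
        filter_upwards [this, self_mem_nhdsWithin] with t ht ht'
        simp [trunc, min_eq_left ((le_of_lt ht').trans h'), max_eq_right ht.le]
      · simp [trunc, min_eq_left h', max_eq_right h.le]

theorem trunc_measure_Ico (y : interval b) (a c : ℝ) :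
    (R.trunc_mono y).stieltjesFunction.measure (Ico a c) =
      ENNReal.ofReal (R.trunc y c - R.trunc y a) := by
  have key : ∀ x, Function.leftLim (R.trunc_mono y).stieltjesFunction x = R.trunc y x := by
    intro x
    rw [← R.trunc_leftLim y x]
    exact leftLim_rightLim ((R.trunc_mono y).tendsto_leftLim x)
  rw [StieltjesFunction.measure_Ico, key, key]

theorem trunc_measure_eq {x y : interval b} (h : (y : ℝ) ≤ x) :
    (R.trunc_mono y).stieltjesFunction.measure =
      (R.trunc_mono x).stieltjesFunction.measure.restrict (Ico 0 (y : ℝ)) := by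
  refine Measure.ext_of_Ico _ _ fun a c hac => ?_
  rw [Measure.restrict_apply measurableSet_Ico, Ico_inter_Ico, trunc_measure_Ico,
    trunc_measure_Ico]
  have hy := y.2.1
  have h1 : R.trunc x (min c (y : ℝ)) = R.trunc y c := by
    simp [trunc, min_assoc, min_eq_left h]
  change _ = ENNReal.ofReal (R.trunc x (min c (y : ℝ)) - R.trunc x (max a 0))
  rw [h1]
  rcases le_or_gt a y with ha | ha
  · have : R.trunc x (max a 0) = R.trunc y a := by
      simp only [trunc]
      congr 1
      rw [min_eq_left (max_le (ha.trans h) (hy.trans h)), min_eq_left ha, max_comm a 0,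
        max_eq_right (le_max_left 0 a)]
    rw [this]
  · have h2 : R.trunc y c = R.trunc y a := by
      simp [trunc, min_eq_right (ha.trans hac).le, min_eq_right ha.le]
    have h3 : R.trunc y a ≤ R.trunc x (max a 0) := by
      rw [← h2, ← h1]
      exact R.trunc_mono x
        ((min_le_right _ _).trans (ha.le.trans (le_max_left _ _)))
    rw [h2, sub_self, ENNReal.ofReal_zero, ENNReal.ofReal_of_nonpos (sub_nonpos.2 h3)]

theorem measure_compl : R.measure (interval b)ᶜ = 0 := by
  have hI : MeasurableSet (interval b) :=
    measurableSet_Ici.inter (measurableSet_lt measurable_coe_real_ereal measurable_const)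
  have hle : R.measure ≤ (⊤ : Measure ℝ).restrict (interval b) := by
    refine iSup_le fun y => ?_
    rw [R.trunc_measure_eq (le_refl (y : ℝ))]
    have hsub : Ico 0 (y : ℝ) ⊆ interval b := fun t ht =>
      ⟨ht.1, (EReal.coe_lt_coe_iff.2 ht.2).trans y.2.2⟩
    exact Measure.restrict_mono hsub le_top
  refine le_antisymm ((hle _).trans_eq ?_) zero_le
  rw [Measure.restrict_apply hI.compl, compl_inter_self, measure_empty]

theorem measure_Ico {x : ℝ} (hx : x ∈ interval b) :
    R.measure (Ico 0 x) = ENNReal.ofReal (R x) := by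
  have hval : (R.trunc_mono ⟨x, hx⟩).stieltjesFunction.measure (Ico 0 x) =
      ENNReal.ofReal (R x) := by
    rw [trunc_measure_Ico]
    simp [trunc, hx.1, R.zero]
  have hge : (R.trunc_mono ⟨x, hx⟩).stieltjesFunction.measure ≤ R.measure :=
    le_iSup (fun y : interval b => (R.trunc_mono y).stieltjesFunction.measure) ⟨x, hx⟩
  refine le_antisymm ?_ (hval ▸ hge (Ico 0 x))
  have hle : R.measure ≤
      (R.trunc_mono ⟨x, hx⟩).stieltjesFunction.measure.restrict (Ico 0 x) +
        (⊤ : Measure ℝ).restrict (Ico 0 x)ᶜ := by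
    refine iSup_le fun y => ?_
    rw [← Measure.restrict_add_restrict_compl (μ := (R.trunc_mono y).stieltjesFunction.measure)
      (measurableSet_Ico (a := (0 : ℝ)) (b := x))]
    refine add_le_add ?_ (Measure.restrict_mono le_rfl le_top)
    rcases le_total (y : ℝ) x with h | h
    · rw [R.trunc_measure_eq (x := ⟨x, hx⟩) (y := y) h]
      exact Measure.restrict_mono le_rfl Measure.restrict_le_self
    · rw [R.trunc_measure_eq (x := y) (y := ⟨x, hx⟩) h, Measure.restrict_restrict
        measurableSet_Ico, inter_self]
  refine (hle _).trans_eq ?_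
  rw [Measure.add_apply, Measure.restrict_apply measurableSet_Ico, inter_self,
    Measure.restrict_apply measurableSet_Ico, inter_compl_self, measure_empty, add_zero, hval]

/-- The value `R(b) = lim_{x → b} R(x)`, for bounded `R`. -/
def endValue : ℝ := sSup (R '' interval b)

/-- `R(b) < ∞`. -/
def Bounded : Prop := BddAbove (R '' interval b)

end DistFun

/-- The data of an integral system `S[R₁, R₂]` on `[0, b)`, `0 < b ≤ ∞`. -/
structure IntegralSystem where
  b : EReal
  b_pos : 0 < b
  R₁ : DistFun b
  R₂ : DistFun b

namespace IntegralSystem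

variable (S : IntegralSystem)

/-- `R₁` and `R₂` have no common points of discontinuity in `[0, b)`. -/
def NoCommonDiscontinuity : Prop :=
  ∀ x ∈ interval S.b, ContinuousWithinAt S.R₁ (interval S.b) x ∨
    ContinuousWithinAt S.R₂ (interval S.b) x

/-- For some `[0, b₀) ⊆ [0, b)` the classes of `1` and `R₁` in `L²(R₂, [0, b₀))` are
linearly independent. -/
def Definite : Prop :=
  ∃ b₀ ∈ interval S.b, ∀ α β : ℂ,
    (∀ᵐ x ∂(S.R₂.measure.restrict (Ico 0 b₀)), α * 1 + β * (S.R₁ x : ℂ) = 0) → α = 0 ∧ β = 0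

/-- Regular at `b`: `R₁(b) + R₂(b) < ∞`. -/
def Regular : Prop := S.R₁.Bounded ∧ S.R₂.Bounded

/-- Singular at `b`: not regular at `b`. -/
def Singular : Prop := ¬ S.Regular

/-- `u = (u₁, u₂)` (components `u x 0`, `u x 1`) solves the homogeneous integral system
`u(x) = u(0) - J ∫_{[0,x)} diag(z dR₂, dR₁) u` on `[0, b)`, `J = [[0, -1], [1, 0]]`, that is
`u₁(x) = u₁(0) + ∫_{[0,x)} u₂ dR₁` and `u₂(x) = u₂(0) - z ∫_{[0,x)} u₁ dR₂`. -/
def IsSolution (z : ℂ) (u : ℝ → Fin 2 → ℂ) : Prop :=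
  ∀ x ∈ interval S.b,
    IntegrableOn (fun t => u t 1) (Ico 0 x) S.R₁.measure ∧
    IntegrableOn (fun t => u t 0) (Ico 0 x) S.R₂.measure ∧
    u x 0 = u 0 0 + ∫ t in Ico 0 x, u t 1 ∂S.R₁.measure ∧
    u x 1 = u 0 1 - z * ∫ t in Ico 0 x, u t 0 ∂S.R₂.measure

/-- The columns `c = (c₁, c₂)`, `s = (s₁, s₂)` of `V = [[c₁, s₁], [c₂, s₂]]` solve the system and
`V 0 = 1`, i.e. `c₁(0) = 1`, `c₂(0) = 0`, `s₁(0) = 0`, `s₂(0) = 1`. -/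
def IsFundamentalMatrix (z : ℂ) (V : ℝ → Matrix (Fin 2) (Fin 2) ℂ) : Prop :=
  V 0 = 1 ∧ ∀ j, S.IsSolution z (fun x i => V x i j)

/-- The fundamental matrix `U(x, z)` of the system (a choice of a function of `x` that satisfies
`IsFundamentalMatrix`; it is determined uniquely on `[0, b)`). -/
def U (z : ℂ) : ℝ → Matrix (Fin 2) (Fin 2) ℂ := Classical.epsilon (S.IsFundamentalMatrix z)

def c₁ (z : ℂ) (x : ℝ) : ℂ := S.U z x 0 0
def c₂ (z : ℂ) (x : ℝ) : ℂ := S.U z x 1 0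
def s₁ (z : ℂ) (x : ℝ) : ℂ := S.U z x 0 1
def s₂ (z : ℂ) (x : ℝ) : ℂ := S.U z x 1 1

/-- The space of all solutions `u` of the system on `[0, b)` with `u₁ ∈ 𝓛²(R₂)`.  (Solutions are
functions on `[0, b)`; they are represented by functions on `ℝ` vanishing off `[0, b)`.) -/
def defectSpace (z : ℂ) : Submodule ℂ (ℝ → Fin 2 → ℂ) where
  carrier := {u | S.IsSolution z u ∧ (∀ x, x ∉ interval S.b → u x = 0) ∧
    MemLp (fun t => u t 0) 2 S.R₂.measure}
  add_mem' := by
    rintro u v ⟨hu, hu0, hu2⟩ ⟨hv, hv0, hv2⟩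
    refine ⟨fun x hx => ?_, fun x hx => by simp [hu0 x hx, hv0 x hx], hu2.add hv2⟩
    obtain ⟨a1, a2, a3, a4⟩ := hu x hx
    obtain ⟨b1, b2, b3, b4⟩ := hv x hx
    refine ⟨a1.add b1, a2.add b2, ?_, ?_⟩
    · simp only [Pi.add_apply]
      rw [integral_add a1 b1, a3, b3]; ring
    · simp only [Pi.add_apply]
      rw [integral_add a2 b2, a4, b4]; ring
  zero_mem' := by
    refine ⟨fun x _ => ?_, fun x _ => rfl, ?_⟩
    · simp
    · simp
  smul_mem' := by
    rintro k u ⟨hu, hu0, hu2⟩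
    refine ⟨fun x hx => ?_, fun x hx => by simp [hu0 x hx], hu2.const_mul k⟩
    obtain ⟨a1, a2, a3, a4⟩ := hu x hx
    refine ⟨a1.const_mul k, a2.const_mul k, ?_, ?_⟩
    · simp only [Pi.smul_apply, smul_eq_mul]
      rw [integral_const_mul, a3]; ring
    · simp only [Pi.smul_apply, smul_eq_mul]
      rw [integral_const_mul, a4]; ring

/-- The limit point case at `b`. -/
def LimitPoint : Prop := ∀ z : ℂ, z.im ≠ 0 → Module.finrank ℂ (S.defectSpace z) = 1

/-- The limit circle case at `b`. -/
def LimitCircle : Prop := ∀ z : ℂ, z.im ≠ 0 → Module.finrank ℂ (S.defectSpace z) = 2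

/-- `m` is the value at `z` of the Neumann `m`-function.  In the limit circle case
`ψ = s - m c` satisfies `ψ₂(b) = 0`; in the limit point case `ψ₁ = s₁ - m c₁ ∈ 𝓛²(R₂)`. -/
def IsNeumann (z m : ℂ) : Prop :=
  (S.LimitCircle ∧ Tendsto (fun x => S.s₂ z x - m * S.c₂ z x) (endFilter S.b) (𝓝 0)) ∨
  (S.LimitPoint ∧ MemLp (fun x => S.s₁ z x - m * S.c₁ z x) 2 S.R₂.measure)

/-- `m` is the value at `z` of the Neumann `m`-function subject to the boundary condition
`u₁(b) = 0`: the solution `ψ = s - m c` satisfies `ψ₁(b) = 0`. -/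
def IsNeumannD (z m : ℂ) : Prop :=
  Tendsto (fun x => S.s₁ z x - m * S.c₁ z x) (endFilter S.b) (𝓝 0)

/-- `q` is the value at `z` of the principal Titchmarsh–Weyl coefficient. -/
def IsPrincipal (z q : ℂ) : Prop :=
  Tendsto (fun x => S.s₁ z x / S.c₁ z x) (endFilter S.b) (𝓝 q)

/-- The system `S[R₂, R₁]`. -/
def swap : IntegralSystem := ⟨S.b, S.b_pos, S.R₂, S.R₁⟩

end IntegralSystem

/-- The continuation of a bounded `R` from `[0, b)`, `b < ∞`, to `[0, ∞)`: it equals `R(x)` for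
`x < b` and `R(b) + k (x - b)` for `x ≥ b`. -/
def DistFun.extend {b : EReal} (R : DistFun b) (hb : 0 < b) (hR : R.Bounded) (k : ℝ) (hk : 0 ≤ k) :
    DistFun ⊤ where
  toFun x := open Classical in if (x : EReal) < b then R x else R.endValue + k * (x - b.toReal)
  mono := by
    have hlt : ∀ {x : ℝ}, ¬ (x : EReal) < b → b.toReal ≤ x := by
      intro x hx
      have h1 : b ≠ ⊤ := by rintro rfl; exact hx (EReal.coe_lt_top x)
      have h2 : b ≠ ⊥ := by rintro rfl; simp at hb
      have h3 := not_lt.1 hx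
      rw [← EReal.coe_toReal h1 h2] at h3
      exact EReal.coe_le_coe_iff.1 h3
    intro x hx y hy hxy
    dsimp only
    by_cases h2 : (y : EReal) < b
    · have h1 : (x : EReal) < b := lt_of_le_of_lt (EReal.coe_le_coe_iff.2 hxy) h2
      rw [if_pos h1, if_pos h2]
      exact R.mono ⟨hx.1, h1⟩ ⟨hy.1, h2⟩ hxy
    · rw [if_neg h2]
      by_cases h1 : (x : EReal) < b
      · rw [if_pos h1]
        have h3 : R x ≤ R.endValue := le_csSup hR ⟨x, ⟨hx.1, h1⟩, rfl⟩
        have h4 := mul_nonneg hk (sub_nonneg.2 (hlt h2))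
        linarith
      · rw [if_neg h1]
        have := mul_le_mul_of_nonneg_left (sub_le_sub_right hxy b.toReal) hk
        linarith
  leftCont := by
    intro x hx
    by_cases h1 : (x : EReal) < b
    · refine (R.leftCont x ⟨hx.1, h1⟩).congr (fun t ht => if_pos ?_) (if_pos h1)
      exact (EReal.coe_lt_coe_iff.2 ht.2).trans h1
    have hb1 : b ≠ ⊤ := by rintro rfl; exact h1 (EReal.coe_lt_top x)
    have hb2 : b ≠ ⊥ := by rintro rfl; simp at hb
    lift b to ℝ using ⟨hb1, hb2⟩
    have hb0 : 0 < b := EReal.coe_pos.1 hb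
    rw [EReal.coe_lt_coe_iff, not_lt] at h1
    simp only [EReal.coe_lt_coe_iff, EReal.toReal_coe]
    have hx0 : 0 < x := hb0.trans_le h1
    rw [ContinuousWithinAt, nhdsWithin_Ico_eq_nhdsLT hx0, if_neg (not_lt.2 h1)]
    have haff : Tendsto (fun t : ℝ => R.endValue + k * (t - b)) (𝓝[<] x)
        (𝓝 (R.endValue + k * (x - b))) := by
      refine Tendsto.mono_left (Continuous.tendsto ?_ x) nhdsWithin_le_nhds
      fun_prop
    rcases h1.lt_or_eq with h2 | rfl
    · refine haff.congr' ?_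
      have : ∀ᶠ t in 𝓝[<] x, b < t := (lt_mem_nhds h2).filter_mono nhdsWithin_le_nhds
      filter_upwards [this] with t ht
      rw [if_neg (not_lt.2 ht.le)]
    · have hI : ∀ t, 0 ≤ t → t < b → t ∈ interval (b : EReal) :=
        fun t h0 h => ⟨h0, EReal.coe_lt_coe_iff.2 h⟩
      rw [sub_self, mul_zero, add_zero]
      have hpos : ∀ᶠ t in 𝓝[<] b, 0 < t := (lt_mem_nhds hb0).filter_mono nhdsWithin_le_nhds
      refine tendsto_order.2 ⟨fun a ha => ?_, fun a ha => ?_⟩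
      · obtain ⟨_, ⟨y, hy, rfl⟩, hay⟩ := exists_lt_of_lt_csSup
          (Set.Nonempty.image R ⟨0, hI 0 le_rfl hb0⟩) ha
        have : ∀ᶠ t in 𝓝[<] b, y < t :=
          (lt_mem_nhds (EReal.coe_lt_coe_iff.1 hy.2)).filter_mono nhdsWithin_le_nhds
        filter_upwards [this, self_mem_nhdsWithin] with t ht htb
        rw [if_pos (show t < b from htb)]
        exact hay.trans_le (R.mono hy (hI t (hy.1.trans ht.le) htb) ht.le)
      · filter_upwards [hpos, self_mem_nhdsWithin] with t ht htb
        rw [if_pos (show t < b from htb)]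
        exact (le_csSup hR ⟨t, hI t ht.le htb, rfl⟩).trans_lt ha
  zero := by
    rw [if_pos (by simpa using hb)]
    exact R.zero

namespace IntegralSystem

variable (S : IntegralSystem)

/-- The canonical singular continuation `S[R̃₁, R̃₂]` of a regular system with `b < ∞`:
`R̃₁(x) = R₁(x)`, `R̃₂(x) = R₂(x)` for `x < b`, and `R̃₁(x) = R₁(b)`, `R̃₂(x) = R₂(b) + x - b`
for `b ≤ x < ∞`. -/
def continuation (h : S.Regular) : IntegralSystem where
  b := ⊤
  b_pos := EReal.zero_lt_top
  R₁ := S.R₁.extend S.b_pos h.1 0 le_rfl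
  R₂ := S.R₂.extend S.b_pos h.2 1 zero_le_one

open Classical in
/-- The dual system: `S[R₂, R₁]` if `S[R₁, R₂]` is singular, and `S[R̃₂, R̃₁]` if it is regular. -/
def dual : IntegralSystem := if h : S.Regular then (S.continuation h).swap else S.swap

end IntegralSystem

/-- The matrix `D(z) = [[0, -1/z], [1, 0]]`. -/
def D (z : ℂ) : Matrix (Fin 2) (Fin 2) ℂ := !![0, -z⁻¹; 1, 0]

end IntSys

end

/-! Everything rests on one quadratic form. For λ off [0,∞) put E(u) = Re((|λ| - λ) u₁ ū₂).
Integration by parts, which is clean because dR₁ and dR₂ share no atoms, shows that along a solution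
E grows by (|λ| - Re λ)(∫|u₂|² dR₁ + |λ| ∫|u₁|² dR₂) (`SolvesOn.energy_sub`). The factor is positive
on all of ℂ∖[0,∞), not only off the real axis, and both measures contribute, so the form also
controls the dual system.

The sets {m : E(s - m c)(x) ≤ 0} are nested in x and have diameter at most ||λ| - λ| / E(c)(x) once
E(c)(x) > 0 (`norm_mul_energy_le`). They contain s₁/c₁ and s₂/c₂, since E vanishes when one
component does. If E(c) stayed bounded, every solution would satisfy u₁ ∈ L²(dR₂) and u₂ ∈ L²(dR₁).
Square integrability of all solutions does not depend on λ (`AllL2.memLp`), and at λ = 0 the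
solution (1, 0) then forces R₂(b) < ∞; the swapped system likewise gives R₁(b) < ∞. So for a
singular system E(c) → ∞, the discs shrink to one point q ≠ 0, and both quotients tend to q
(`NoCommonAtoms.exists_weyl`).

The number q is also m_N: in the limit circle case as the limit of s₂/c₂, in the limit point case
because s - q c has bounded energy (`isNeumann_iff`). Conjugation by D turns ŝ₁/ĉ₁ into -c₂/(λ s₂),
whose limit is -1/(λq). A regular system is replaced by its continuation, which is singular and
whose solutions have constant first component beyond b; hence its coefficient is s₁(b)/c₁(b) = m_ND
(`Regular.exists_boundary_values`). -/

noncomputable section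

namespace IntSys

/-! ### Grönwall's inequality for measures with atoms -/

section Gronwall

/-- The iterated integrals `1`, `∫_{s < x} dν`, `∫_{s < t < x} dν dν`, … of a measure. -/
def iterInt (ν : Measure ℝ) : ℕ → ℝ → ENNReal
  | 0, _ => 1
  | n + 1, x => ∫⁻ t in Iio x, iterInt ν n t ∂ν

theorem iterInt_mono (ν : Measure ℝ) (n : ℕ) : Monotone (iterInt ν n) := by
  cases n with
  | zero => exact monotone_const
  | succ n =>
    intro x y hxy
    exact lintegral_mono_set (Iio_subset_Iio hxy)

theorem measurable_iterInt (ν : Measure ℝ) (n : ℕ) : Measurable (iterInt ν n) :=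
  (iterInt_mono ν n).measurable

/-- By Tonelli the two terms are the integrals of f(t) g(s) over s < t and over t < s. The diagonal,
which atoms may charge, is dropped; this is why only an inequality holds. -/
theorem lintegral_parts_le (ν : Measure ℝ) [IsFiniteMeasure ν] {f g : ℝ → ENNReal}
    (hf : Measurable f) (hg : Measurable g) (x : ℝ) :
    ∫⁻ t in Iio x, f t * (∫⁻ s in Iio t, g s ∂ν) ∂ν +
      ∫⁻ t in Iio x, (∫⁻ s in Iio t, f s ∂ν) * g t ∂ν ≤
    (∫⁻ t in Iio x, f t ∂ν) * ∫⁻ t in Iio x, g t ∂ν := by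
  set ρ := ν.restrict (Iio x) with hρ
  have hset : MeasurableSet {p : ℝ × ℝ | p.2 < p.1} := measurableSet_lt measurable_snd measurable_fst
  have hin : ∀ k : ℝ → ENNReal, ∀ t ∈ Iio x,
      ∫⁻ s in Iio t, k s ∂ν = ∫⁻ s, (Iio t).indicator k s ∂ρ := by
    intro k t ht
    rw [lintegral_indicator measurableSet_Iio, hρ, Measure.restrict_restrict measurableSet_Iio,
      inter_eq_left.2 (Iio_subset_Iio (le_of_lt ht))]
  have hmem : ∀ᵐ t ∂ρ, t ∈ Iio x := ae_restrict_mem measurableSet_Iio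
  have h1 : ∫⁻ t, f t * (∫⁻ s in Iio t, g s ∂ν) ∂ρ =
      ∫⁻ t, ∫⁻ s, {p : ℝ × ℝ | p.2 < p.1}.indicator (fun p => f p.1 * g p.2) (t, s) ∂ρ ∂ρ := by
    refine lintegral_congr_ae (hmem.mono fun t ht => ?_)
    dsimp only
    rw [hin g t ht, ← lintegral_const_mul _ (hg.indicator measurableSet_Iio)]
    refine lintegral_congr fun s => ?_
    by_cases hs : s < t <;> simp [indicator, hs]
  have h2 : ∫⁻ t, (∫⁻ s in Iio t, f s ∂ν) * g t ∂ρ =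
      ∫⁻ t, ∫⁻ s, {p : ℝ × ℝ | p.1 < p.2}.indicator (fun p => f p.1 * g p.2) (t, s) ∂ρ ∂ρ := by
    rw [lintegral_lintegral_swap]
    · refine lintegral_congr_ae (hmem.mono fun t ht => ?_)
      dsimp only
      rw [hin f t ht, ← lintegral_mul_const _ (hf.indicator measurableSet_Iio)]
      refine lintegral_congr fun s => ?_
      by_cases hs : s < t <;> simp [indicator, hs]
    · refine Measurable.aemeasurable ?_
      refine Measurable.indicator ?_ (measurableSet_lt measurable_fst measurable_snd)
      exact (hf.comp measurable_fst).mul (hg.comp measurable_snd)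
  have hm : Measurable ({p : ℝ × ℝ | p.2 < p.1}.indicator (fun p => f p.1 * g p.2)) :=
    ((hf.comp measurable_fst).mul (hg.comp measurable_snd)).indicator hset
  rw [h1, h2, ← lintegral_add_left (Measurable.lintegral_prod_right' hm),
    ← lintegral_mul_const _ hf]
  refine lintegral_mono fun t => ?_
  have hmt : Measurable fun s =>
      {p : ℝ × ℝ | p.2 < p.1}.indicator (fun p => f p.1 * g p.2) (t, s) :=
    hm.comp measurable_prodMk_left
  dsimp only
  rw [← lintegral_const_mul _ hg, ← lintegral_add_left hmt]
  refine lintegral_mono fun s => ?_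
  dsimp only
  rcases lt_trichotomy s t with h | h | h
  · simp [indicator, h, not_lt.2 h.le]
  · simp [indicator, h]
  · simp [indicator, h, not_lt.2 h.le]

/-- Integration by parts with f = 1 moves one integration outside; iterating gives the simplex
volume bound with 1/n!, valid even when ν has atoms because the iterated integrals use strict
inequalities. -/
theorem succ_mul_iterInt_le (ν : Measure ℝ) [IsFiniteMeasure ν] (n : ℕ) (x : ℝ) :
    (n + 1 : ENNReal) * iterInt ν (n + 1) x ≤ ν (Iio x) * iterInt ν n x := by
  induction n generalizing x with
  | zero => simp [iterInt]
  | succ n ih =>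
    have key := lintegral_parts_le ν (f := fun _ => 1) measurable_const
      (measurable_iterInt ν n) x
    simp only [one_mul, lintegral_one, Measure.restrict_apply MeasurableSet.univ, univ_inter]
      at key
    refine le_trans ?_ key
    have h2 : (n + 1 : ENNReal) * iterInt ν (n + 2) x ≤
        ∫⁻ t in Iio x, ν (Iio t) * iterInt ν n t ∂ν := by
      change _ * ∫⁻ t in Iio x, iterInt ν (n + 1) t ∂ν ≤ _
      rw [← lintegral_const_mul _ (measurable_iterInt ν _)]
      exact lintegral_mono fun t => ih t
    push_cast
    rw [add_mul, one_mul, add_comm]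
    exact add_le_add le_rfl h2

theorem iterInt_le (ν : Measure ℝ) [IsFiniteMeasure ν] (n : ℕ) (x : ℝ) :
    iterInt ν n x ≤ ENNReal.ofReal (ν.real univ ^ n / n.factorial) := by
  have hM : ν (Iio x) ≤ ENNReal.ofReal (ν.real univ) := by
    rw [ofReal_measureReal]; exact measure_mono (subset_univ _)
  induction n with
  | zero => simp [iterInt]
  | succ n ih =>
    have h1 := (succ_mul_iterInt_le ν n x).trans (mul_le_mul' hM ih)
    rw [← ENNReal.ofReal_mul measureReal_nonneg] at h1
    have h2 : (n + 1 : ENNReal) = ENNReal.ofReal (n + 1) := by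
      rw [ENNReal.ofReal_add (by positivity) zero_le_one]; simp
    have hpos : (0 : ℝ) < n + 1 := by positivity
    rw [h2, mul_comm, ← ENNReal.le_div_iff_mul_le (by simp [hpos]) (by simp),
      ← ENNReal.ofReal_div_of_pos hpos] at h1
    refine h1.trans_eq ?_
    congr 1
    rw [Nat.factorial_succ, pow_succ]
    push_cast
    field_simp

/-- Grönwall's inequality for a finite measure. -/
theorem gronwall_Iio (ν : Measure ℝ) [IsFiniteMeasure ν] {φ : ℝ → ENNReal} {B C : ENNReal} {X : ℝ}
    (hB : B ≠ ⊤) (hφ : ∀ᵐ x ∂ν, φ x ≤ B)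
    (h : ∀ᵐ x ∂ν, φ x ≤ C + ∫⁻ t in Iio x, φ t ∂ν)
    (hX : φ X ≤ C + ∫⁻ t in Iio X, φ t ∂ν) :
    φ X ≤ C * ENNReal.ofReal (Real.exp (ν.real univ)) := by
  -- The hypothesis is fed into itself: each substitution adds one iterated integral to the sum and
  -- pushes the crude bound B into a remainder of order Mⁿ/n!.
  have hint : ∀ n, ∀ x, (∀ᵐ t ∂ν, φ t ≤ C * ∑ k ∈ Finset.range n, iterInt ν k t + B * iterInt ν n t) →
      C + ∫⁻ t in Iio x, φ t ∂ν ≤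
        C * ∑ k ∈ Finset.range (n + 1), iterInt ν k x + B * iterInt ν (n + 1) x := by
    intro n x hn
    have h1 := lintegral_mono_ae (ae_restrict_of_ae (s := Iio x) hn)
    rw [lintegral_add_right _ ((measurable_iterInt ν n).const_mul B),
      lintegral_const_mul _ (measurable_iterInt ν n), lintegral_const_mul _
        (Finset.measurable_fun_sum _ fun k _ => measurable_iterInt ν k),
      lintegral_finsetSum _ (fun k _ => measurable_iterInt ν k)] at h1
    refine (add_le_add le_rfl h1).trans_eq ?_
    rw [Finset.sum_range_succ', mul_add, ← add_assoc, add_comm C]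
    simp [iterInt]
  have hall : ∀ n, ∀ᵐ t ∂ν,
      φ t ≤ C * ∑ k ∈ Finset.range n, iterInt ν k t + B * iterInt ν n t := by
    intro n
    induction n with
    | zero => simpa [iterInt] using hφ
    | succ n ih => exact h.mono fun x hx => hx.trans (hint n x ih)
  have hX' : ∀ n : ℕ, φ X ≤ C * ENNReal.ofReal (Real.exp (ν.real univ)) +
      B * ENNReal.ofReal (ν.real univ ^ (n + 1) / (n + 1).factorial) := by
    intro n
    refine (hX.trans (hint n X (hall n))).trans (add_le_add ?_ ?_)
    · gcongr
      refine (Finset.sum_le_sum fun k _ => iterInt_le ν k X).trans ?_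
      rw [← ENNReal.ofReal_sum_of_nonneg (fun k _ => by positivity)]
      exact ENNReal.ofReal_le_ofReal (Real.sum_le_exp_of_nonneg measureReal_nonneg _)
    · gcongr
      exact iterInt_le ν _ X
  refine ge_of_tendsto' (x := atTop) ?_ hX'
  have h0 := (FloorSemiring.tendsto_pow_div_factorial_atTop (ν.real univ)).comp
    (tendsto_add_atTop_nat 1)
  have h1 := ENNReal.tendsto_ofReal h0
  rw [ENNReal.ofReal_zero] at h1
  have h2 := (ENNReal.Tendsto.const_mul h1 (Or.inr hB)).const_add
    (C * ENNReal.ofReal (Real.exp (ν.real univ)))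
  simpa using h2

theorem gronwall_Ico (ν : Measure ℝ) {φ : ℝ → ENNReal} {B C : ENNReal} {X : ℝ} (hX : 0 ≤ X)
    (hν : ν (Ico 0 X) ≠ ⊤) (hB : B ≠ ⊤) (hφ : ∀ x ∈ Icc 0 X, φ x ≤ B)
    (h : ∀ x ∈ Icc 0 X, φ x ≤ C + ∫⁻ t in Ico 0 x, φ t ∂ν) :
    φ X ≤ C * ENNReal.ofReal (Real.exp (ν.real (Ico 0 X))) := by
  have hfin : IsFiniteMeasure (ν.restrict (Ico 0 X)) := ⟨by simpa using hν.lt_top⟩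
  have hres : ∀ x ∈ Icc 0 X, ∫⁻ t in Iio x, φ t ∂(ν.restrict (Ico 0 X)) =
      ∫⁻ t in Ico 0 x, φ t ∂ν := by
    intro x hx
    rw [Measure.restrict_restrict measurableSet_Iio]
    congr 2
    ext t
    simp only [mem_inter_iff, mem_Iio, mem_Ico]
    exact ⟨fun h => ⟨h.2.1, h.1⟩, fun h => ⟨h.2, h.1, h.2.trans_le hx.2⟩⟩
  have hmem : ∀ᵐ t ∂(ν.restrict (Ico 0 X)), t ∈ Ico 0 X := ae_restrict_mem measurableSet_Ico
  have := gronwall_Iio (ν.restrict (Ico 0 X)) (φ := φ) (B := B) (C := C) (X := X) hB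
    (hmem.mono fun t ht => hφ t (Ico_subset_Icc_self ht))
    (hmem.mono fun t ht => by
      rw [hres t (Ico_subset_Icc_self ht)]; exact h t (Ico_subset_Icc_self ht))
    (by rw [hres X ⟨hX, le_rfl⟩]; exact h X ⟨hX, le_rfl⟩)
  simpa [measureReal_restrict_apply] using this

end Gronwall

/-! ### Integration by parts for two measures without common atoms -/

section Parts

/-- A finite measure has countably many atoms, and μ gives each atom of ν mass zero. -/
theorem ae_measure_singleton_eq_zero {μ ν : Measure ℝ} [IsFiniteMeasure ν]
    (hat : ∀ t, μ {t} = 0 ∨ ν {t} = 0) : ∀ᵐ t ∂μ, ν {t} = 0 := by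
  have hc : {t : ℝ | 0 < ν {t}}.Countable :=
    Measure.countable_meas_pos_of_disjoint_iUnion (μ := ν) (As := fun t : ℝ => {t})
      (fun t => measurableSet_singleton t)
      (fun s t hst => by simpa [Function.onFun] using hst)
  have h0 : μ {t : ℝ | 0 < ν {t}} = 0 := by
    rw [← biUnion_of_singleton {t : ℝ | 0 < ν {t}}, measure_biUnion_null_iff hc]
    intro t ht
    exact (hat t).resolve_right (ne_of_gt ht)
  refine measure_mono_null (fun t ht => ?_) h0
  exact pos_iff_ne_zero.2 ht

/-- Fubini on the two triangles off the diagonal; the diagonal is null for μ × ν exactly because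
there is no common atom. -/
theorem integral_mul_integral {μ ν : Measure ℝ} [IsFiniteMeasure μ] [IsFiniteMeasure ν]
    (hat : ∀ t, μ {t} = 0 ∨ ν {t} = 0) {f g : ℝ → ℂ} (hf : Integrable f μ)
    (hg : Integrable g ν) :
    (∫ t, f t ∂μ) * ∫ t, g t ∂ν =
      ∫ t, f t * (∫ s in Iio t, g s ∂ν) ∂μ + ∫ t, (∫ s in Iio t, f s ∂μ) * g t ∂ν ∧
    Integrable (fun t => f t * ∫ s in Iio t, g s ∂ν) μ ∧
    Integrable (fun t => (∫ s in Iio t, f s ∂μ) * g t) ν := by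
  set k : ℝ × ℝ → ℂ := fun p => f p.1 * g p.2 with hk
  have hki : Integrable k (μ.prod ν) := hf.mul_prod hg
  have hA : MeasurableSet {p : ℝ × ℝ | p.2 < p.1} := measurableSet_lt measurable_snd measurable_fst
  have hB : MeasurableSet {p : ℝ × ℝ | p.1 < p.2} := measurableSet_lt measurable_fst measurable_snd
  have hD : MeasurableSet {p : ℝ × ℝ | p.1 = p.2} := measurableSet_eq_fun measurable_fst measurable_snd
  have hdiag : (μ.prod ν) {p : ℝ × ℝ | p.1 = p.2} = 0 := by
    rw [Measure.measure_prod_null hD]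
    filter_upwards [ae_measure_singleton_eq_zero hat] with t ht
    have : Prod.mk t ⁻¹' {p : ℝ × ℝ | p.1 = p.2} = {t} := by
      ext s; simp [eq_comm]
    rw [this, ht]; rfl
  have hkA := hki.indicator hA
  have hkB := hki.indicator hB
  have hsum : ∫ p, k p ∂(μ.prod ν) = ∫ p, {p : ℝ × ℝ | p.2 < p.1}.indicator k p ∂(μ.prod ν) +
      ∫ p, {p : ℝ × ℝ | p.1 < p.2}.indicator k p ∂(μ.prod ν) := by
    rw [← integral_add hkA hkB]
    refine integral_congr_ae ?_
    have : ∀ᵐ p ∂(μ.prod ν), p ∉ {p : ℝ × ℝ | p.1 = p.2} := measure_eq_zero_iff_ae_notMem.1 hdiag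
    filter_upwards [this] with p hp
    rcases lt_trichotomy p.1 p.2 with h | h | h
    · simp [indicator, h, not_lt.2 h.le]
    · exact absurd h hp
    · simp [indicator, h, not_lt.2 h.le]
  have e1 : ∀ t, ∫ s, {p : ℝ × ℝ | p.2 < p.1}.indicator k (t, s) ∂ν =
      f t * ∫ s in Iio t, g s ∂ν := by
    intro t
    rw [← integral_const_mul, ← integral_indicator measurableSet_Iio]
    refine integral_congr_ae (ae_of_all _ fun s => ?_)
    by_cases h : s < t <;> simp [indicator, h, hk]
  have e2 : ∀ t, ∫ s, {p : ℝ × ℝ | p.1 < p.2}.indicator k (s, t) ∂μ =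
      (∫ s in Iio t, f s ∂μ) * g t := by
    intro t
    rw [← integral_mul_const, ← integral_indicator measurableSet_Iio]
    refine integral_congr_ae (ae_of_all _ fun s => ?_)
    by_cases h : s < t <;> simp [indicator, h, hk]
  refine ⟨?_, ?_, ?_⟩
  · rw [← integral_prod_mul, hsum, integral_prod _ hkA, integral_prod_symm _ hkB]
    simp_rw [e1, e2]
  · simpa only [e1] using hkA.integral_prod_left
  · simpa only [e2] using hkB.integral_prod_right

theorem restrict_Ico_restrict_Iio (μ : Measure ℝ) {x X : ℝ} (h : x ≤ X) :
    (μ.restrict (Ico 0 X)).restrict (Iio x) = μ.restrict (Ico 0 x) := by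
  rw [Measure.restrict_restrict measurableSet_Iio]
  congr 1
  ext t
  simp only [mem_inter_iff, mem_Iio, mem_Ico]
  exact ⟨fun h => ⟨h.2.1, h.1⟩, fun h' => ⟨h'.2, h'.1, h'.2.trans_le h⟩⟩

/-- Integration by parts for primitives with respect to two measures without common atoms. -/
theorem mul_sub_mul_eq_integral {μ ν : Measure ℝ} {X : ℝ} (hX : 0 ≤ X)
    (hμ : μ (Ico 0 X) ≠ ⊤) (hν : ν (Ico 0 X) ≠ ⊤)
    (hat : ∀ t, μ {t} = 0 ∨ ν {t} = 0) {f g F G : ℝ → ℂ} (hf : IntegrableOn f (Ico 0 X) μ)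
    (hg : IntegrableOn g (Ico 0 X) ν)
    (hF : ∀ x ∈ Icc 0 X, F x = F 0 + ∫ t in Ico 0 x, f t ∂μ)
    (hG : ∀ x ∈ Icc 0 X, G x = G 0 + ∫ t in Ico 0 x, g t ∂ν) :
    F X * G X - F 0 * G 0 =
      ∫ t in Ico 0 X, f t * G t ∂μ + ∫ t in Ico 0 X, F t * g t ∂ν := by
  have i1 : IsFiniteMeasure (μ.restrict (Ico 0 X)) := ⟨by simpa using hμ.lt_top⟩
  have i2 : IsFiniteMeasure (ν.restrict (Ico 0 X)) := ⟨by simpa using hν.lt_top⟩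
  have hat' : ∀ t, (μ.restrict (Ico 0 X)) {t} = 0 ∨ (ν.restrict (Ico 0 X)) {t} = 0 := fun t =>
    (hat t).imp (fun h => le_antisymm ((Measure.restrict_le_self _).trans_eq h) zero_le)
      (fun h => le_antisymm ((Measure.restrict_le_self _).trans_eq h) zero_le)
  obtain ⟨k1, k2, k3⟩ := integral_mul_integral hat' hf hg
  have e1 : ∫ t in Ico 0 X, f t * G t ∂μ = (∫ t in Ico 0 X, f t ∂μ) * G 0 +
      ∫ t in Ico 0 X, f t * (∫ s in Iio t, g s ∂(ν.restrict (Ico 0 X))) ∂μ := by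
    rw [← integral_mul_const, ← integral_add (hf.mul_const _) k2]
    refine setIntegral_congr_fun measurableSet_Ico fun t ht => ?_
    rw [hG t (Ico_subset_Icc_self ht), restrict_Ico_restrict_Iio ν ht.2.le, mul_add]
  have e2 : ∫ t in Ico 0 X, F t * g t ∂ν = F 0 * (∫ t in Ico 0 X, g t ∂ν) +
      ∫ t in Ico 0 X, (∫ s in Iio t, f s ∂(μ.restrict (Ico 0 X))) * g t ∂ν := by
    rw [← integral_const_mul, ← integral_add (hg.const_mul _) k3]
    refine setIntegral_congr_fun measurableSet_Ico fun t ht => ?_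
    rw [hF t (Ico_subset_Icc_self ht), restrict_Ico_restrict_Iio μ ht.2.le, add_mul]
  rw [e1, e2, hF X ⟨hX, le_rfl⟩, hG X ⟨hX, le_rfl⟩]
  linear_combination k1

end Parts

/-! ### Existence of solutions by Picard iteration -/

section Existence

theorem stronglyMeasurable_integral_Iio (μ : Measure ℝ) [SFinite μ] {f : ℝ → ℂ}
    (hf : StronglyMeasurable f) : StronglyMeasurable fun x => ∫ t in Iio x, f t ∂μ := by
  have h : StronglyMeasurable fun p : ℝ × ℝ =>
      {p : ℝ × ℝ | p.2 < p.1}.indicator (fun p => f p.2) p :=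
    (hf.comp_measurable measurable_snd).indicator (measurableSet_lt measurable_snd measurable_fst)
  have h2 := h.integral_prod_right' (ν := μ)
  convert h2 using 2 with x
  rw [← integral_indicator measurableSet_Iio]
  refine integral_congr_ae (ae_of_all _ fun s => ?_)
  by_cases h : s < x <;> simp [indicator, h]

/-- The terms of the Picard series of the integral system with finite measures. -/
def picard (μ ν : Measure ℝ) (z a d : ℂ) : ℕ → (ℝ → ℂ) × (ℝ → ℂ)
  | 0 => (fun _ => a, fun _ => d)
  | n + 1 => (fun x => ∫ t in Iio x, (picard μ ν z a d n).2 t ∂μ,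
      fun x => -z * ∫ t in Iio x, (picard μ ν z a d n).1 t ∂ν)

theorem stronglyMeasurable_picard (μ ν : Measure ℝ) [IsFiniteMeasure μ] [IsFiniteMeasure ν]
    (z a d : ℂ) (n : ℕ) : StronglyMeasurable (picard μ ν z a d n).1 ∧
    StronglyMeasurable (picard μ ν z a d n).2 := by
  induction n with
  | zero => exact ⟨stronglyMeasurable_const, stronglyMeasurable_const⟩
  | succ n ih =>
    exact ⟨stronglyMeasurable_integral_Iio μ ih.2,
      (stronglyMeasurable_integral_Iio ν ih.1).const_mul (-z)⟩

/-- One Picard step is one integration against μ or |z|ν, so the sum of these measures majorises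
both components at once, and the factorial bound makes the series converge uniformly. -/
theorem enorm_picard_le (μ ν : Measure ℝ) (z a d : ℂ) (n : ℕ) (x : ℝ) :
    ‖(picard μ ν z a d n).1 x‖ₑ ≤ (‖a‖ₑ + ‖d‖ₑ) * iterInt (μ + ‖z‖₊ • ν) n x ∧
    ‖(picard μ ν z a d n).2 x‖ₑ ≤ (‖a‖ₑ + ‖d‖ₑ) * iterInt (μ + ‖z‖₊ • ν) n x := by
  induction n generalizing x with
  | zero => simp [picard, iterInt]
  | succ n ih =>
    have hK := (measurable_iterInt (μ + ‖z‖₊ • ν) n)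
    simp only [picard, iterInt]
    rw [← lintegral_const_mul _ hK, Measure.restrict_add, lintegral_add_measure,
      Measure.restrict_smul, lintegral_smul_measure]
    constructor
    · refine ((enorm_integral_le_lintegral_enorm _).trans
        (lintegral_mono fun t => (ih t).2)).trans le_self_add
    · rw [enorm_mul, enorm_neg]
      refine le_trans ?_ le_add_self
      rw [ENNReal.smul_def, smul_eq_mul]
      exact mul_le_mul' le_rfl ((enorm_integral_le_lintegral_enorm _).trans
        (lintegral_mono fun t => (ih t).1))

theorem exists_solution_of_finite (μ ν : Measure ℝ) [IsFiniteMeasure μ] [IsFiniteMeasure ν]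
    (z a d : ℂ) : ∃ u v : ℝ → ℂ, Integrable v μ ∧ Integrable u ν ∧
    (∀ x, u x = a + ∫ t in Iio x, v t ∂μ) ∧ ∀ x, v x = d - z * ∫ t in Iio x, u t ∂ν := by
  set M := (μ + ‖z‖₊ • ν).real univ with hM
  set bd : ℕ → ℝ := fun n => (‖a‖ + ‖d‖) * (M ^ n / n.factorial) with hbd
  have hs : Summable bd := (Real.summable_pow_div_factorial M).mul_left _
  have hconv : ∀ n x w, ‖w‖ₑ ≤ (‖a‖ₑ + ‖d‖ₑ) * iterInt (μ + ‖z‖₊ • ν) n x →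
      ‖(w : ℂ)‖ ≤ bd n := by
    intro n x w h
    have h1 := h.trans (mul_le_mul' le_rfl (iterInt_le (μ + ‖z‖₊ • ν) n x))
    rw [← ofReal_norm, ← ofReal_norm, ← ofReal_norm,
      ← ENNReal.ofReal_add (norm_nonneg _) (norm_nonneg _),
      ← ENNReal.ofReal_mul (by positivity)] at h1
    exact (ENNReal.ofReal_le_ofReal_iff (by positivity)).1 h1
  have hb1 : ∀ n x, ‖(picard μ ν z a d n).1 x‖ ≤ bd n := fun n x =>
    hconv n x _ (enorm_picard_le μ ν z a d n x).1
  have hb2 : ∀ n x, ‖(picard μ ν z a d n).2 x‖ ≤ bd n := fun n x =>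
    hconv n x _ (enorm_picard_le μ ν z a d n x).2
  have key : ∀ (ρ : Measure ℝ) [IsFiniteMeasure ρ] (w : ℕ → ℝ → ℂ),
      (∀ n, StronglyMeasurable (w n)) → (∀ n x, ‖w n x‖ ≤ bd n) →
      Integrable (fun x => ∑' n, w n x) ρ ∧
        ∀ x, ∫ t in Iio x, ∑' n, w n t ∂ρ = ∑' n, ∫ t in Iio x, w n t ∂ρ := by
    intro ρ _ w hw hwb
    have hsm : ∀ x, Summable fun n => w n x := fun x => hs.of_norm_bounded (fun n => hwb n x)
    have hlim : StronglyMeasurable fun x => ∑' n, w n x := by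
      refine stronglyMeasurable_of_tendsto (u := atTop)
        (f := fun N x => ∑ n ∈ Finset.range N, w n x) ?_ ?_
      · intro N
        exact Finset.stronglyMeasurable_fun_sum _ fun n _ => hw n
      · exact tendsto_pi_nhds.2 fun x => (hsm x).hasSum.tendsto_sum_nat
    refine ⟨Integrable.of_bound hlim.aestronglyMeasurable (∑' n, bd n) (ae_of_all _ fun x =>
      tsum_of_norm_bounded hs.hasSum (fun n => hwb n x)), fun x => ?_⟩
    refine (integral_tsum_of_summable_integral_norm (fun n => ?_) ?_).symm
    · exact Integrable.of_bound (hw n).aestronglyMeasurable (bd n) (ae_of_all _ (hwb n))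
    · refine (hs.mul_right (ρ.real (Iio x))).of_nonneg_of_le
        (fun n => integral_nonneg fun _ => norm_nonneg _) (fun n => ?_)
      have := norm_setIntegral_le_of_norm_le_const (μ := ρ) (s := Iio x) (C := bd n)
        (f := fun t => (‖w n t‖ : ℝ)) (measure_lt_top _ _) (fun t _ => by simpa using hwb n t)
      exact (le_abs_self _).trans this
  obtain ⟨i1, k1⟩ := key ν (fun n => (picard μ ν z a d n).1)
    (fun n => (stronglyMeasurable_picard μ ν z a d n).1) hb1
  obtain ⟨i2, k2⟩ := key μ (fun n => (picard μ ν z a d n).2)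
    (fun n => (stronglyMeasurable_picard μ ν z a d n).2) hb2
  refine ⟨_, _, i2, i1, fun x => ?_, fun x => ?_⟩
  · rw [k2 x, (hs.of_norm_bounded fun n => hb1 n x).tsum_eq_zero_add]
    rfl
  · rw [k1 x, (hs.of_norm_bounded fun n => hb2 n x).tsum_eq_zero_add, ← tsum_mul_left,
      sub_eq_add_neg, ← tsum_neg]
    simp only [picard, neg_mul]

end Existence

/-! ### The interval [0, b) and the limit at its right end -/

section Interval

variable {b : EReal}

theorem zero_mem_interval (hb : 0 < b) : (0 : ℝ) ∈ interval b := ⟨le_rfl, by simpa using hb⟩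

theorem mem_interval_of_le {x t : ℝ} (hx : x ∈ interval b) (h0 : 0 ≤ t) (h : t ≤ x) :
    t ∈ interval b :=
  ⟨h0, (EReal.coe_le_coe_iff.2 h).trans_lt hx.2⟩

theorem mem_interval_of_mem_Icc {x t : ℝ} (hx : x ∈ interval b) (h : t ∈ Icc 0 x) :
    t ∈ interval b :=
  mem_interval_of_le hx h.1 h.2

theorem exists_gt_mem_interval {x : ℝ} (hx : x ∈ interval b) : ∃ y ∈ interval b, x < y := by
  obtain ⟨y, h1, h2⟩ := EReal.lt_iff_exists_real_btwn.1 hx.2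
  have h3 : x < y := EReal.coe_lt_coe_iff.1 h1
  exact ⟨y, ⟨hx.1.trans h3.le, h2⟩, h3⟩

theorem measurableSet_interval : MeasurableSet (interval b) :=
  measurableSet_Ici.inter (measurableSet_lt measurable_coe_real_ereal measurable_const)

theorem exists_seq_interval (hb : 0 < b) : ∃ y : ℕ → ℝ, (∀ n, y n ∈ interval b) ∧ Monotone y ∧
    ∀ x ∈ interval b, ∀ᶠ n in atTop, x < y n := by
  obtain ⟨u, hu, hub, hlim⟩ := exists_seq_strictMono_tendsto' hb
  have hcoe : ∀ n, ((u n).toReal : EReal) = u n := fun n =>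
    EReal.coe_toReal ((hub n).2.trans_le le_top).ne (EReal.bot_lt_zero.trans (hub n).1).ne'
  refine ⟨fun n => (u n).toReal, fun n => ⟨?_, ?_⟩, fun m n h => ?_, fun x hx => ?_⟩
  · rw [← EReal.coe_nonneg, hcoe]; exact (hub n).1.le
  · rw [hcoe]; exact (hub n).2
  · rw [← EReal.coe_le_coe_iff, hcoe, hcoe]; exact hu.monotone h
  · filter_upwards [hlim.eventually (lt_mem_nhds hx.2)] with n hn
    rwa [← EReal.coe_lt_coe_iff, hcoe]

theorem eventually_endFilter (hb : 0 < b) {P : ℝ → Prop} :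
    (∀ᶠ x in endFilter b, P x) ↔ ∃ y ∈ interval b, ∀ x ∈ interval b, y ≤ x → P x := by
  rw [endFilter, eventually_comap]
  constructor
  · intro h
    obtain ⟨a, ha, hP⟩ := (mem_nhdsLT_iff_exists_Ioo_subset' hb).1 h
    obtain ⟨y, hy1, hy2⟩ := EReal.lt_iff_exists_real_btwn.1 (max_lt hb ha)
    have hy0 : 0 ≤ y := EReal.coe_nonneg.1 ((le_max_left _ _).trans hy1.le)
    refine ⟨y, ⟨hy0, hy2⟩, fun x hx hyx => hP (a := (x : EReal)) ⟨?_, hx.2⟩ x rfl⟩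
    exact ((le_max_right _ _).trans_lt hy1).trans_le (EReal.coe_le_coe_iff.2 hyx)
  · rintro ⟨y, hy, hP⟩
    have : Ioo (y : EReal) b ∈ 𝓝[<] b := Ioo_mem_nhdsLT hy.2
    filter_upwards [this] with e he x hx
    subst hx
    have h1 : y ≤ x := (EReal.coe_lt_coe_iff.1 he.1).le
    exact hP x ⟨hy.1.trans h1, he.2⟩ h1

theorem eventually_mem_interval (hb : 0 < b) : ∀ᶠ x in endFilter b, x ∈ interval b :=
  (eventually_endFilter hb).2 ⟨0, zero_mem_interval hb, fun _ hx _ => hx⟩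

theorem eventually_ge_endFilter (hb : 0 < b) {y : ℝ} (hy : y ∈ interval b) :
    ∀ᶠ x in endFilter b, y ≤ x :=
  (eventually_endFilter hb).2 ⟨y, hy, fun _ _ h => h⟩

theorem endFilter_neBot (hb : 0 < b) : (endFilter b).NeBot := by
  refine ⟨fun h => ?_⟩
  have : ∀ᶠ x in endFilter b, False := by rw [h]; exact eventually_bot
  obtain ⟨y, hy, h⟩ := (eventually_endFilter hb).1 this
  exact h y hy le_rfl

instance : (endFilter b).IsCountablyGenerated := by
  unfold endFilter; infer_instance

/-- Dominated convergence for the cut-off integrands: each t < b eventually lies in [0, x). -/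
theorem tendsto_integral_endFilter (hb : 0 < b) {μ : Measure ℝ} {f : ℝ → ℂ}
    (hf : IntegrableOn f (interval b) μ) :
    Tendsto (fun x => ∫ t in Ico 0 x, f t ∂μ) (endFilter b) (𝓝 (∫ t in interval b, f t ∂μ)) := by
  have hev : (fun x => ∫ t in interval b, (Ico 0 x).indicator f t ∂μ) =ᶠ[endFilter b]
      fun x => ∫ t in Ico 0 x, f t ∂μ := by
    filter_upwards [eventually_mem_interval hb] with x hx
    rw [integral_indicator measurableSet_Ico, Measure.restrict_restrict measurableSet_Ico,
      inter_eq_left.2 fun t ht => mem_interval_of_le hx ht.1 ht.2.le]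
  refine Tendsto.congr' hev ?_
  refine tendsto_integral_filter_of_dominated_convergence (fun t => ‖f t‖) ?_ ?_ hf.norm ?_
  · exact Eventually.of_forall fun x => hf.aestronglyMeasurable.indicator measurableSet_Ico
  · exact Eventually.of_forall fun x => ae_of_all _ fun t => norm_indicator_le_norm_self _ _
  · filter_upwards [ae_restrict_mem measurableSet_interval] with t ht
    obtain ⟨y, hy, hty⟩ := exists_gt_mem_interval ht
    refine tendsto_const_nhds.congr' ?_
    filter_upwards [eventually_ge_endFilter hb hy] with x hx
    rw [indicator_of_mem (show t ∈ Ico 0 x from ⟨ht.1, hty.trans_le hx⟩)]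

end Interval

/-! ### The Lebesgue–Stieltjes measure of a left-continuous function -/

namespace DistFun

variable {b : EReal} (R : DistFun b)

theorem nonneg {x : ℝ} (hx : x ∈ interval b) : 0 ≤ R x := by
  rw [← R.zero]
  exact R.mono (mem_interval_of_le hx le_rfl hx.1) hx hx.1

theorem measure_Ico_ne_top {x : ℝ} (hx : x ∈ interval b) : R.measure (Ico 0 x) ≠ ⊤ := by
  rw [R.measure_Ico hx]; exact ENNReal.ofReal_ne_top

theorem measureReal_Ico {x : ℝ} (hx : x ∈ interval b) : R.measure.real (Ico 0 x) = R x := by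
  rw [measureReal_def, R.measure_Ico hx, ENNReal.toReal_ofReal (R.nonneg hx)]

theorem ae_mem_interval : ∀ᵐ x ∂(R.measure), x ∈ interval b := by
  have := R.measure_compl
  rwa [← mem_ae_iff] at this

theorem measure_Ico_of_le {x y : ℝ} (hx : x ∈ interval b) (hy : y ∈ interval b) (h : x ≤ y) :
    R.measure (Ico x y) = ENNReal.ofReal (R y - R x) := by
  have h1 : Ico x y = Ico 0 y \ Ico 0 x := by
    ext t
    simp only [mem_Ico, Set.mem_sdiff, not_and, not_lt]
    exact ⟨fun ht => ⟨⟨hx.1.trans ht.1, ht.2⟩, fun _ => ht.1⟩, fun ht => ⟨ht.2 ht.1.1, ht.1.2⟩⟩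
  rw [h1, measure_sdiff (Ico_subset_Ico_right h) measurableSet_Ico.nullMeasurableSet
    (R.measure_Ico_ne_top hx), R.measure_Ico hx, R.measure_Ico hy,
    ENNReal.ofReal_sub _ (R.nonneg hx)]

theorem measure_singleton_le {x y : ℝ} (hx : x ∈ interval b) (hy : y ∈ interval b) (h : x < y) :
    R.measure {x} ≤ ENNReal.ofReal (R y - R x) := by
  rw [← R.measure_Ico_of_le hx hy h.le]
  exact measure_mono (singleton_subset_iff.2 ⟨le_rfl, h⟩)

/-- The mass at x is at most R t - R x for every t > x in the interval, so continuity from the right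
removes it. -/
theorem measure_singleton_eq_zero {x : ℝ} (hx : x ∈ interval b)
    (h : ContinuousWithinAt R (interval b) x) : R.measure {x} = 0 := by
  obtain ⟨y, hy, hxy⟩ := exists_gt_mem_interval hx
  have hsub : Ioo x y ⊆ interval b := fun t ht => mem_interval_of_le hy (hx.1.trans ht.1.le) ht.2.le
  have h1 : Tendsto R (𝓝[Ioo x y] x) (𝓝 (R x)) := h.mono hsub
  rw [nhdsWithin_Ioo_eq_nhdsGT hxy] at h1
  have h2 : Tendsto (fun t => ENNReal.ofReal (R t - R x)) (𝓝[>] x) (𝓝 0) := by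
    have := ENNReal.tendsto_ofReal (h1.sub_const (R x))
    simpa using this
  refine le_antisymm (ge_of_tendsto h2 ?_) zero_le
  filter_upwards [Ioo_mem_nhdsGT hxy] with t ht
  exact R.measure_singleton_le hx (hsub ht) ht.1

/-- Serves to compare a function with its continuation, which lives on a different interval. -/
theorem restrict_measure_congr {b' : EReal} (R' : DistFun b') {x : ℝ} (hx : x ∈ interval b)
    (hx' : x ∈ interval b') (h : ∀ t ∈ Icc 0 x, R t = R' t) :
    R.measure.restrict (Ico 0 x) = R'.measure.restrict (Ico 0 x) := by
  have i1 : IsFiniteMeasure (R.measure.restrict (Ico 0 x)) :=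
    ⟨by simpa using (R.measure_Ico_ne_top hx).lt_top⟩
  refine Measure.ext_of_Ico _ _ fun a c _ => ?_
  rw [Measure.restrict_apply measurableSet_Ico, Measure.restrict_apply measurableSet_Ico,
    Ico_inter_Ico]
  rcases le_or_gt (max a 0) (min c x) with hac | hac
  · have h1 : max a 0 ∈ Icc 0 x := ⟨le_max_right _ _, hac.trans (min_le_right _ _)⟩
    have h2 : min c x ∈ Icc 0 x := ⟨h1.1.trans hac, min_le_right _ _⟩
    change R.measure (Ico (max a 0) (min c x)) = R'.measure (Ico (max a 0) (min c x))
    rw [R.measure_Ico_of_le (mem_interval_of_mem_Icc hx h1) (mem_interval_of_mem_Icc hx h2) hac,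
      R'.measure_Ico_of_le (mem_interval_of_mem_Icc hx' h1) (mem_interval_of_mem_Icc hx' h2) hac,
      h _ h1, h _ h2]
  · change R.measure (Ico (max a 0) (min c x)) = R'.measure (Ico (max a 0) (min c x))
    rw [Ico_eq_empty hac.not_gt, measure_empty, measure_empty]

theorem aecover_Ico {y : ℕ → ℝ} (hy : ∀ x ∈ interval b, ∀ᶠ n in atTop, x < y n) :
    AECover R.measure atTop fun n => Ico 0 (y n) where
  ae_eventually_mem := by
    filter_upwards [R.ae_mem_interval] with x hx
    filter_upwards [hy x hx] with n hn
    exact ⟨hx.1, hn⟩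
  measurableSet _ := measurableSet_Ico

theorem aestronglyMeasurable_of_restrict (hb : 0 < b) {f : ℝ → ℂ}
    (hf : ∀ x ∈ interval b, AEStronglyMeasurable f (R.measure.restrict (Ico 0 x))) :
    AEStronglyMeasurable f R.measure := by
  obtain ⟨y, hy, -, hlim⟩ := exists_seq_interval hb
  exact (R.aecover_Ico hlim).aestronglyMeasurable fun n => hf _ (hy n)

theorem memLp_two_of_integral_le (hb : 0 < b) {f : ℝ → ℂ} {C : ℝ}
    (hf : ∀ x ∈ interval b, AEStronglyMeasurable f (R.measure.restrict (Ico 0 x)))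
    (hi : ∀ x ∈ interval b, IntegrableOn (fun t => ‖f t‖ ^ 2) (Ico 0 x) R.measure)
    (hC : ∀ x ∈ interval b, ∫ t in Ico 0 x, ‖f t‖ ^ 2 ∂(R.measure) ≤ C) : MemLp f 2 R.measure := by
  rw [memLp_two_iff_integrable_sq_norm (R.aestronglyMeasurable_of_restrict hb hf)]
  obtain ⟨y, hy, -, hlim⟩ := exists_seq_interval hb
  exact (R.aecover_Ico hlim).integrable_of_integral_bounded_of_nonneg_ae C (fun n => hi _ (hy n))
    (ae_of_all _ fun t => by positivity) (Eventually.of_forall fun n => hC _ (hy n))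

theorem bounded_of_measure_ne_top (h : R.measure univ ≠ ⊤) : R.Bounded := by
  refine ⟨R.measure.real univ, ?_⟩
  rintro _ ⟨x, hx, rfl⟩
  rw [← R.measureReal_Ico hx]
  exact measureReal_mono (subset_univ _) h

end DistFun

/-! ### Solutions on a compact interval: uniqueness, Lagrange and energy identities -/

/-- `(u, v)` solves on `[0, X]` the integral system with measures `μ`, `ν` and parameter `z`. -/
structure SolvesOn (μ ν : Measure ℝ) (z : ℂ) (u v : ℝ → ℂ) (X : ℝ) : Prop where
  integrable_snd : IntegrableOn v (Ico 0 X) μ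
  integrable_fst : IntegrableOn u (Ico 0 X) ν
  fst_eq : ∀ x ∈ Icc 0 X, u x = u 0 + ∫ t in Ico 0 x, v t ∂μ
  snd_eq : ∀ x ∈ Icc 0 X, v x = v 0 - z * ∫ t in Ico 0 x, u t ∂ν

namespace SolvesOn

variable {μ ν : Measure ℝ} {z w : ℂ} {u v p r : ℝ → ℂ} {X : ℝ}

theorem mono (h : SolvesOn μ ν z u v X) {Y : ℝ} (hY : Y ≤ X) : SolvesOn μ ν z u v Y where
  integrable_snd := h.integrable_snd.mono_set (Ico_subset_Ico_right hY)
  integrable_fst := h.integrable_fst.mono_set (Ico_subset_Ico_right hY)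
  fst_eq x hx := h.fst_eq x ⟨hx.1, hx.2.trans hY⟩
  snd_eq x hx := h.snd_eq x ⟨hx.1, hx.2.trans hY⟩

theorem congr (h : SolvesOn μ ν z u v X) (hX : 0 ≤ X) (hp : EqOn u p (Icc 0 X))
    (hr : EqOn v r (Icc 0 X)) : SolvesOn μ ν z p r X where
  integrable_snd := h.integrable_snd.congr_fun (hr.mono Ico_subset_Icc_self) measurableSet_Ico
  integrable_fst := h.integrable_fst.congr_fun (hp.mono Ico_subset_Icc_self) measurableSet_Ico
  fst_eq x hx := by
    rw [← hp hx, ← hp ⟨le_rfl, hX⟩, h.fst_eq x hx]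
    congr 1
    exact setIntegral_congr_fun measurableSet_Ico fun t ht => hr ⟨ht.1, ht.2.le.trans hx.2⟩
  snd_eq x hx := by
    rw [← hr hx, ← hr ⟨le_rfl, hX⟩, h.snd_eq x hx]
    congr 2
    exact setIntegral_congr_fun measurableSet_Ico fun t ht => hp ⟨ht.1, ht.2.le.trans hx.2⟩

theorem integrable_fst_of_mem (h : SolvesOn μ ν z u v X) {x : ℝ} (hx : x ∈ Icc 0 X) :
    IntegrableOn u (Ico 0 x) ν :=
  h.integrable_fst.mono_set (Ico_subset_Ico_right hx.2)

theorem integrable_snd_of_mem (h : SolvesOn μ ν z u v X) {x : ℝ} (hx : x ∈ Icc 0 X) :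
    IntegrableOn v (Ico 0 x) μ :=
  h.integrable_snd.mono_set (Ico_subset_Ico_right hx.2)

theorem linear_comb (h : SolvesOn μ ν z u v X) (h' : SolvesOn μ ν z p r X) (k l : ℂ) :
    SolvesOn μ ν z (fun x => k * u x + l * p x) (fun x => k * v x + l * r x) X where
  integrable_snd := (h.integrable_snd.const_mul k).add (h'.integrable_snd.const_mul l)
  integrable_fst := (h.integrable_fst.const_mul k).add (h'.integrable_fst.const_mul l)
  fst_eq x hx := by
    rw [integral_add ((h.integrable_snd_of_mem hx).const_mul k)
      ((h'.integrable_snd_of_mem hx).const_mul l), integral_const_mul, integral_const_mul,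
      h.fst_eq x hx, h'.fst_eq x hx]
    ring
  snd_eq x hx := by
    rw [integral_add ((h.integrable_fst_of_mem hx).const_mul k)
      ((h'.integrable_fst_of_mem hx).const_mul l), integral_const_mul, integral_const_mul,
      h.snd_eq x hx, h'.snd_eq x hx]
    ring

theorem conj (h : SolvesOn μ ν z u v X) : SolvesOn μ ν (starRingEnd ℂ z)
    (fun x => starRingEnd ℂ (u x)) (fun x => starRingEnd ℂ (v x)) X where
  integrable_snd := (LinearIsometryEquiv.integrable_comp_iff Complex.conjLIE).2 h.integrable_snd
  integrable_fst := (LinearIsometryEquiv.integrable_comp_iff Complex.conjLIE).2 h.integrable_fst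
  fst_eq x hx := by rw [integral_conj, h.fst_eq x hx, map_add]
  snd_eq x hx := by rw [integral_conj, h.snd_eq x hx, map_sub, map_mul]

/-- Supplies the a priori finite bound that Grönwall's inequality needs before its iteration can
start. -/
theorem exists_bound (h : SolvesOn μ ν z u v X) : ∃ C : ℝ, 0 ≤ C ∧
    ∀ x ∈ Icc 0 X, ‖u x‖ ≤ C ∧ ‖v x‖ ≤ C := by
  have key : ∀ {ρ : Measure ℝ} {f : ℝ → ℂ}, IntegrableOn f (Ico 0 X) ρ → ∀ x ∈ Icc 0 X,
      ‖∫ t in Ico 0 x, f t ∂ρ‖ ≤ ∫ t in Ico 0 X, ‖f t‖ ∂ρ := by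
    intro ρ f hf x hx
    refine (norm_integral_le_integral_norm _).trans ?_
    exact setIntegral_mono_set hf.norm (ae_of_all _ fun t => norm_nonneg _)
      (Ico_subset_Ico_right hx.2).eventuallyLE
  set A := ∫ t in Ico 0 X, ‖v t‖ ∂μ with hA
  set B := ∫ t in Ico 0 X, ‖u t‖ ∂ν with hB
  have hA0 : 0 ≤ A := integral_nonneg fun _ => norm_nonneg _
  have hB0 : 0 ≤ B := integral_nonneg fun _ => norm_nonneg _
  have h1 := norm_nonneg (u 0)
  have h2 := norm_nonneg (v 0)
  have h3 : 0 ≤ ‖z‖ * B := mul_nonneg (norm_nonneg _) hB0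
  refine ⟨‖u 0‖ + ‖v 0‖ + A + ‖z‖ * B, by positivity, fun x hx => ⟨?_, ?_⟩⟩
  · rw [h.fst_eq x hx]
    have := norm_add_le (u 0) (∫ t in Ico 0 x, v t ∂μ)
    have := key h.integrable_snd x hx
    linarith
  · rw [h.snd_eq x hx]
    have h5 := norm_sub_le (v 0) (z * ∫ t in Ico 0 x, u t ∂ν)
    rw [norm_mul] at h5
    have := mul_le_mul_of_nonneg_left (key h.integrable_fst x hx) (norm_nonneg z)
    linarith

/-- Grönwall with C = 0, applied to |u| + |v| and the measure μ + |z|ν. -/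
theorem eq_zero (h : SolvesOn μ ν z u v X) (hμ : μ (Ico 0 X) ≠ ⊤) (hν : ν (Ico 0 X) ≠ ⊤)
    (hu : u 0 = 0) (hv : v 0 = 0) : ∀ x ∈ Icc 0 X, u x = 0 ∧ v x = 0 := by
  intro Y hY
  obtain ⟨C, hC0, hC⟩ := h.exists_bound
  set ρ : Measure ℝ := μ + ‖z‖₊ • ν with hρ
  have hfin : ρ (Ico 0 Y) ≠ ⊤ := by
    have h1 := (measure_mono (Ico_subset_Ico_right hY.2) : μ (Ico 0 Y) ≤ μ (Ico 0 X))
    have h2 := (measure_mono (Ico_subset_Ico_right hY.2) : ν (Ico 0 Y) ≤ ν (Ico 0 X))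
    rw [hρ, Measure.add_apply, Measure.smul_apply, ENNReal.smul_def]
    exact ENNReal.add_ne_top.2 ⟨ne_top_of_le_ne_top hμ h1,
      ENNReal.mul_ne_top (by simp) (ne_top_of_le_ne_top hν h2)⟩
  have hle : ∀ x ∈ Icc 0 Y, ‖u x‖ₑ + ‖v x‖ₑ ≤ 0 + ∫⁻ t in Ico 0 x, (‖u t‖ₑ + ‖v t‖ₑ) ∂ρ := by
    intro x hx
    have hx' : x ∈ Icc 0 X := ⟨hx.1, hx.2.trans hY.2⟩
    rw [zero_add, hρ, Measure.restrict_add, lintegral_add_measure, Measure.restrict_smul,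
      lintegral_smul_measure, ENNReal.smul_def, smul_eq_mul]
    refine add_le_add ?_ ?_
    · rw [h.fst_eq x hx', hu, zero_add]
      exact (enorm_integral_le_lintegral_enorm _).trans (lintegral_mono fun t => le_add_self)
    · rw [h.snd_eq x hx', hv, zero_sub, enorm_neg, enorm_mul]
      exact mul_le_mul' le_rfl ((enorm_integral_le_lintegral_enorm _).trans
        (lintegral_mono fun t => le_self_add))
  have hbd : ∀ x ∈ Icc 0 Y, ‖u x‖ₑ + ‖v x‖ₑ ≤ ENNReal.ofReal C + ENNReal.ofReal C := by
    intro x hx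
    obtain ⟨h1, h2⟩ := hC x ⟨hx.1, hx.2.trans hY.2⟩
    rw [← ofReal_norm, ← ofReal_norm]
    exact add_le_add (ENNReal.ofReal_le_ofReal h1) (ENNReal.ofReal_le_ofReal h2)
  have := gronwall_Ico ρ (φ := fun x => ‖u x‖ₑ + ‖v x‖ₑ) hY.1 hfin (by simp) hbd hle
  simpa using this

theorem eqOn (h : SolvesOn μ ν z u v X) (h' : SolvesOn μ ν z p r X) (hμ : μ (Ico 0 X) ≠ ⊤)
    (hν : ν (Ico 0 X) ≠ ⊤) (hu : u 0 = p 0) (hv : v 0 = r 0) :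
    ∀ x ∈ Icc 0 X, u x = p x ∧ v x = r x := by
  intro x hx
  have := (h.linear_comb h' 1 (-1)).eq_zero hμ hν (by simp [hu]) (by simp [hv]) x hx
  constructor
  · linear_combination this.1
  · linear_combination this.2

variable (hμ : μ (Ico 0 X) ≠ ⊤) (hν : ν (Ico 0 X) ≠ ⊤) (hat : ∀ t, μ {t} = 0 ∨ ν {t} = 0)

include hμ hν hat

theorem mul_eq (h : SolvesOn μ ν z u v X) (h' : SolvesOn μ ν w p r X) (hX : 0 ≤ X) :
    u X * r X - u 0 * r 0 =
      ∫ t in Ico 0 X, v t * r t ∂μ - w * ∫ t in Ico 0 X, u t * p t ∂ν := by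
  have := mul_sub_mul_eq_integral (F := u) (G := r) (f := v) (g := fun t => -w * p t) hX hμ hν hat
    h.integrable_snd (h'.integrable_fst.const_mul (-w)) h.fst_eq (fun x hx => by
      rw [integral_const_mul, h'.snd_eq x hx]; ring)
  rw [this, sub_eq_add_neg, ← integral_const_mul, ← integral_neg]
  congr 1
  refine integral_congr_ae (ae_of_all _ fun t => ?_)
  ring

/-- Lagrange identity: in the difference of the product formulas for u r and p v the integrals
against μ cancel. -/
theorem wronskian_sub (h : SolvesOn μ ν z u v X) (h' : SolvesOn μ ν w p r X) (hX : 0 ≤ X) :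
    (u X * r X - v X * p X) - (u 0 * r 0 - v 0 * p 0) =
      (z - w) * ∫ t in Ico 0 X, u t * p t ∂ν := by
  have h1 := h.mul_eq hμ hν hat h' hX
  have h2 := h'.mul_eq hμ hν hat h hX
  have e1 : ∫ t in Ico 0 X, r t * v t ∂μ = ∫ t in Ico 0 X, v t * r t ∂μ := by
    simp_rw [mul_comm]
  have e2 : ∫ t in Ico 0 X, p t * u t ∂ν = ∫ t in Ico 0 X, u t * p t ∂ν := by
    simp_rw [mul_comm]
  rw [e1, e2] at h2
  linear_combination h1 - h2

/-- The energy identity. -/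
theorem mul_conj_eq (h : SolvesOn μ ν z u v X) (hX : 0 ≤ X) :
    u X * starRingEnd ℂ (v X) - u 0 * starRingEnd ℂ (v 0) =
      ((∫ t in Ico 0 X, ‖v t‖ ^ 2 ∂μ : ℝ) : ℂ) -
        starRingEnd ℂ z * ((∫ t in Ico 0 X, ‖u t‖ ^ 2 ∂ν : ℝ) : ℂ) := by
  rw [h.mul_eq hμ hν hat h.conj hX, ← integral_complex_ofReal, ← integral_complex_ofReal]
  simp only [Complex.mul_conj, Complex.normSq_eq_norm_sq]

end SolvesOn

/-! ### The energy form and the size of the Weyl discs -/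

/-- The quadratic form `Re ((|z| - z) u \bar v)`. -/
def energy (z u v : ℂ) : ℝ := (((‖z‖ : ℂ) - z) * (u * starRingEnd ℂ v)).re

/-- The weight |z| - z is chosen so that, multiplied by ∫|v|² - z̄ ∫|u|², its real part has two
coefficients that are both nonnegative multiples of |z| - Re z. -/
theorem SolvesOn.energy_sub {μ ν : Measure ℝ} {z : ℂ} {u v : ℝ → ℂ} {X : ℝ}
    (h : SolvesOn μ ν z u v X) (hμ : μ (Ico 0 X) ≠ ⊤) (hν : ν (Ico 0 X) ≠ ⊤)
    (hat : ∀ t, μ {t} = 0 ∨ ν {t} = 0) (hX : 0 ≤ X) :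
    energy z (u X) (v X) - energy z (u 0) (v 0) =
      (‖z‖ - z.re) * (∫ t in Ico 0 X, ‖v t‖ ^ 2 ∂μ + ‖z‖ * ∫ t in Ico 0 X, ‖u t‖ ^ 2 ∂ν) := by
  have h1 := h.mul_conj_eq hμ hν hat hX
  have hz : ‖z‖ ^ 2 = z.re * z.re + z.im * z.im := by
    rw [Complex.sq_norm, Complex.normSq_apply]
  unfold energy
  rw [← Complex.sub_re, ← mul_sub, h1]
  simp only [Complex.mul_re, Complex.sub_re, Complex.sub_im, Complex.ofReal_re, Complex.ofReal_im,
    Complex.mul_im, Complex.conj_re, Complex.conj_im]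
  linear_combination (-(∫ t in Ico 0 X, ‖u t‖ ^ 2 ∂ν)) * hz

/-- The disc estimate: two vectors in the negative cone of the energy form that have Wronskian `1`
with `c` differ by a small multiple of `c`. -/
theorem norm_mul_energy_le {z c₁ c₂ s₁ s₂ m m' : ℂ} (hW : c₁ * s₂ - c₂ * s₁ = 1)
    (hc : 0 < energy z c₁ c₂) (hm : energy z (s₁ - m * c₁) (s₂ - m * c₂) ≤ 0)
    (hm' : energy z (s₁ - m' * c₁) (s₂ - m' * c₂) ≤ 0) :
    ‖m - m'‖ * energy z c₁ c₂ ≤ ‖(‖z‖ : ℂ) - z‖ := by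
  set ω : ℂ := (‖z‖ : ℂ) - z with hω
  -- P m is the polarised energy form evaluated at (s - m c, c); it is affine in m with slope minus
  -- the energy of c.
  set P : ℂ → ℂ := fun m => (ω * ((s₁ - m * c₁) * starRingEnd ℂ c₂) +
    starRingEnd ℂ ω * ((s₂ - m * c₂) * starRingEnd ℂ c₁)) / 2 with hP
  have key : ∀ m, energy z (s₁ - m * c₁) (s₂ - m * c₂) ≤ 0 → ‖P m‖ ≤ ‖ω‖ / 2 := by
    intro m hm
    set t := s₁ - m * c₁ with ht
    set r := s₂ - m * c₂ with hr
    have hW' : c₁ * r - c₂ * t = 1 := by rw [ht, hr]; linear_combination hW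
    -- Gram determinant identity: the Hermitian matrix of the energy form has determinant -|ω|²/4.
    -- With Wronskian 1 it puts P m in the disc of radius |ω|/2 about 0.
    have hid : Complex.normSq (P m) = energy z c₁ c₂ * energy z t r +
        Complex.normSq ω / 4 * Complex.normSq (c₁ * r - c₂ * t) := by
      simp only [hP, ← ht, ← hr, energy, ← hω, Complex.normSq_div]
      simp only [Complex.normSq_apply, Complex.mul_re, Complex.add_re, Complex.add_im,
        Complex.mul_im, Complex.conj_re, Complex.conj_im, Complex.sub_re, Complex.sub_im,
        Complex.re_ofNat, Complex.im_ofNat]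
      ring
    rw [hW', map_one, mul_one, Complex.normSq_eq_norm_sq, Complex.normSq_eq_norm_sq] at hid
    have h1 : energy z c₁ c₂ * energy z t r ≤ 0 := mul_nonpos_of_nonneg_of_nonpos hc.le hm
    refine (sq_le_sq₀ (norm_nonneg _) (by positivity)).1 ?_
    rw [hid]
    linarith
  have hdiff : P m' - P m = (m - m') * ((energy z c₁ c₂ : ℝ) : ℂ) := by
    simp only [hP, energy, ← hω, Complex.re_eq_add_conj, map_mul, Complex.conj_conj]
    ring
  have h1 := norm_sub_le (P m') (P m)
  rw [hdiff, norm_mul, Complex.norm_real, Real.norm_of_nonneg hc.le] at h1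
  linarith [key m hm, key m' hm']

/-! ### The fundamental matrix: existence, uniqueness, Wronskian -/

namespace IntegralSystem

variable (S : IntegralSystem)

theorem isSolution_iff {z : ℂ} {u : ℝ → Fin 2 → ℂ} : S.IsSolution z u ↔
    ∀ X ∈ interval S.b, SolvesOn S.R₁.measure S.R₂.measure z (fun x => u x 0) (fun x => u x 1) X := by
  constructor
  · intro h X hX
    exact ⟨(h X hX).1, (h X hX).2.1, fun x hx => (h x (mem_interval_of_mem_Icc hX hx)).2.2.1,
      fun x hx => (h x (mem_interval_of_mem_Icc hX hx)).2.2.2⟩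
  · intro h X hX
    exact ⟨(h X hX).integrable_snd, (h X hX).integrable_fst,
      (h X hX).fst_eq X ⟨hX.1, le_rfl⟩, (h X hX).snd_eq X ⟨hX.1, le_rfl⟩⟩

theorem IsSolution.congr {S : IntegralSystem} {z : ℂ} {u v : ℝ → Fin 2 → ℂ}
    (h : S.IsSolution z u) (huv : EqOn u v (interval S.b)) : S.IsSolution z v := by
  rw [isSolution_iff] at h ⊢
  intro X hX
  exact (h X hX).congr hX.1 (fun x hx => congrFun (huv (mem_interval_of_mem_Icc hX hx)) 0)
    (fun x hx => congrFun (huv (mem_interval_of_mem_Icc hX hx)) 1)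

theorem IsSolution.eqOn {S : IntegralSystem} {z : ℂ} {u v : ℝ → Fin 2 → ℂ}
    (h : S.IsSolution z u) (h' : S.IsSolution z v) (h0 : u 0 = v 0) :
    EqOn u v (interval S.b) := by
  rw [isSolution_iff] at h h'
  intro X hX
  have := (h X hX).eqOn (h' X hX) (S.R₁.measure_Ico_ne_top hX) (S.R₂.measure_Ico_ne_top hX)
    (by rw [h0]) (by rw [h0]) X ⟨hX.1, le_rfl⟩
  funext i
  fin_cases i
  exacts [this.1, this.2]

theorem exists_solvesOn (z a d : ℂ) {X : ℝ} (hX : X ∈ interval S.b) :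
    ∃ u v : ℝ → ℂ, u 0 = a ∧ v 0 = d ∧ SolvesOn S.R₁.measure S.R₂.measure z u v X := by
  have i1 : IsFiniteMeasure (S.R₁.measure.restrict (Ico 0 X)) :=
    ⟨by simpa using (S.R₁.measure_Ico_ne_top hX).lt_top⟩
  have i2 : IsFiniteMeasure (S.R₂.measure.restrict (Ico 0 X)) :=
    ⟨by simpa using (S.R₂.measure_Ico_ne_top hX).lt_top⟩
  obtain ⟨u, v, hv, hu, hu', hv'⟩ := exists_solution_of_finite
    (S.R₁.measure.restrict (Ico 0 X)) (S.R₂.measure.restrict (Ico 0 X)) z a d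
  have e1 : ∀ x ∈ Icc 0 X, u x = a + ∫ t in Ico 0 x, v t ∂S.R₁.measure := fun x hx => by
    rw [hu' x, restrict_Ico_restrict_Iio _ hx.2]
  have e2 : ∀ x ∈ Icc 0 X, v x = d - z * ∫ t in Ico 0 x, u t ∂S.R₂.measure := fun x hx => by
    rw [hv' x, restrict_Ico_restrict_Iio _ hx.2]
  have h1 : u 0 = a := by rw [e1 0 ⟨le_rfl, hX.1⟩]; simp
  have h2 : v 0 = d := by rw [e2 0 ⟨le_rfl, hX.1⟩]; simp
  exact ⟨u, v, h1, h2, hv, hu, fun x hx => h1 ▸ e1 x hx, fun x hx => h2 ▸ e2 x hx⟩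

theorem exists_isSolution (z : ℂ) (u₀ : Fin 2 → ℂ) :
    ∃ u : ℝ → Fin 2 → ℂ, u 0 = u₀ ∧ S.IsSolution z u := by
  classical
  choose! p r hp hr h using fun (X : ℝ) (hX : X ∈ interval S.b) =>
    S.exists_solvesOn z (u₀ 0) (u₀ 1) hX
  have h0 := zero_mem_interval S.b_pos
  -- The value at x is read off the solution built on [0, x]; by uniqueness these solutions agree on
  -- common intervals.
  refine ⟨fun x => ![p x x, r x x], ?_, ?_⟩
  · funext i
    fin_cases i
    exacts [hp 0 h0, hr 0 h0]
  · rw [isSolution_iff]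
    intro X hX
    have hE : ∀ x ∈ Icc 0 X, p X x = p x x ∧ r X x = r x x := fun x hx => by
      have hx' := mem_interval_of_mem_Icc hX hx
      exact ((h X hX).mono hx.2).eqOn (h x hx') (S.R₁.measure_Ico_ne_top hx')
        (S.R₂.measure_Ico_ne_top hx') (by rw [hp X hX, hp x hx']) (by rw [hr X hX, hr x hx'])
        x ⟨hx.1, le_rfl⟩
    exact (h X hX).congr hX.1 (fun x hx => (hE x hx).1) (fun x hx => (hE x hx).2)

theorem isFundamentalMatrix_U (z : ℂ) : S.IsFundamentalMatrix z (S.U z) := by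
  refine Classical.epsilon_spec (p := S.IsFundamentalMatrix z) ?_
  choose u hu hS using fun j : Fin 2 => S.exists_isSolution z (fun i => (1 : Matrix _ _ ℂ) i j)
  refine ⟨fun x i j => u j x i, ?_, hS⟩
  funext i j
  exact congrFun (hu j) i

theorem isFundamentalMatrix_iff (z : ℂ) (V : ℝ → Matrix (Fin 2) (Fin 2) ℂ) :
    S.IsFundamentalMatrix z V ↔ EqOn V (S.U z) (interval S.b) := by
  obtain ⟨h0, hU⟩ := S.isFundamentalMatrix_U z
  constructor
  · rintro ⟨hV0, hV⟩ x hx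
    funext i j
    exact congrFun ((hV j).eqOn (hU j) (by rw [hV0, h0]) hx) i
  · intro h
    refine ⟨by rw [h (zero_mem_interval S.b_pos), h0], fun j => (hU j).congr fun x hx => ?_⟩
    funext i
    rw [h hx]

theorem U_apply_zero (z : ℂ) : S.U z 0 = 1 := (S.isFundamentalMatrix_U z).1

@[simp] theorem c₁_zero (z : ℂ) : S.c₁ z 0 = 1 := by simp [c₁, U_apply_zero]
@[simp] theorem c₂_zero (z : ℂ) : S.c₂ z 0 = 0 := by simp [c₂, U_apply_zero]
@[simp] theorem s₁_zero (z : ℂ) : S.s₁ z 0 = 0 := by simp [s₁, U_apply_zero]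
@[simp] theorem s₂_zero (z : ℂ) : S.s₂ z 0 = 1 := by simp [s₂, U_apply_zero]

theorem solvesOn_c (z : ℂ) {X : ℝ} (hX : X ∈ interval S.b) :
    SolvesOn S.R₁.measure S.R₂.measure z (S.c₁ z) (S.c₂ z) X :=
  S.isSolution_iff.1 ((S.isFundamentalMatrix_U z).2 0) X hX

theorem solvesOn_s (z : ℂ) {X : ℝ} (hX : X ∈ interval S.b) :
    SolvesOn S.R₁.measure S.R₂.measure z (S.s₁ z) (S.s₂ z) X :=
  S.isSolution_iff.1 ((S.isFundamentalMatrix_U z).2 1) X hX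

theorem solvesOn_sub_mul (z m : ℂ) {X : ℝ} (hX : X ∈ interval S.b) :
    SolvesOn S.R₁.measure S.R₂.measure z (fun x => S.s₁ z x - m * S.c₁ z x)
      (fun x => S.s₂ z x - m * S.c₂ z x) X := by
  have := (S.solvesOn_s z hX).linear_comb (S.solvesOn_c z hX) 1 (-m)
  simpa only [one_mul, neg_mul, ← sub_eq_add_neg] using this

/-- `R₁` and `R₂` have no common atoms. -/
def NoCommonAtoms : Prop := ∀ t, S.R₁.measure {t} = 0 ∨ S.R₂.measure {t} = 0

/-- Neither of the measures `dR₁`, `dR₂` vanishes. -/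
def Nondegenerate : Prop := ∃ x ∈ interval S.b, 0 < S.R₁ x ∧ 0 < S.R₂ x

variable {S}

theorem NoCommonDiscontinuity.noCommonAtoms (h : S.NoCommonDiscontinuity) : S.NoCommonAtoms := by
  intro t
  by_cases ht : t ∈ interval S.b
  · exact (h t ht).imp (S.R₁.measure_singleton_eq_zero ht) (S.R₂.measure_singleton_eq_zero ht)
  · exact Or.inl (measure_mono_null (singleton_subset_iff.2 ht) S.R₁.measure_compl)

/-- If R₁(b₀) = 0, the class of R₁ is zero; if R₂(b₀) = 0, the whole space L²(dR₂, [0, b₀)) is zero.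
Both contradict independence. Only this positivity is used later. -/
theorem Definite.nondegenerate (h : S.Definite) : S.Nondegenerate := by
  obtain ⟨b₀, hb₀, h⟩ := h
  refine ⟨b₀, hb₀, (S.R₁.nonneg hb₀).lt_of_ne fun h1 => ?_, (S.R₂.nonneg hb₀).lt_of_ne fun h2 => ?_⟩
  · refine one_ne_zero (h 0 1 ?_).2
    filter_upwards [ae_restrict_mem measurableSet_Ico] with t ht
    have ht' := mem_interval_of_le hb₀ ht.1 ht.2.le
    have := (S.R₁.mono ht' hb₀ ht.2.le).antisymm (h1 ▸ S.R₁.nonneg ht')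
    simp [this, ← h1]
  · refine one_ne_zero (h 1 0 ?_).1
    have : S.R₂.measure.restrict (Ico 0 b₀) = 0 := by
      rw [Measure.restrict_eq_zero, S.R₂.measure_Ico hb₀, ← h2, ENNReal.ofReal_zero]
    rw [this]
    simp

theorem NoCommonAtoms.swap (h : S.NoCommonAtoms) : S.swap.NoCommonAtoms := fun t => (h t).symm

theorem Nondegenerate.swap (h : S.Nondegenerate) : S.swap.Nondegenerate := by
  obtain ⟨x, hx, h1, h2⟩ := h
  exact ⟨x, hx, h2, h1⟩

theorem Singular.swap (h : S.Singular) : S.swap.Singular := fun h' => h ⟨h'.2, h'.1⟩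

theorem NoCommonAtoms.wronskian (h : S.NoCommonAtoms) (z : ℂ) {x : ℝ} (hx : x ∈ interval S.b) :
    S.c₁ z x * S.s₂ z x - S.c₂ z x * S.s₁ z x = 1 := by
  have := (S.solvesOn_c z hx).wronskian_sub (S.R₁.measure_Ico_ne_top hx)
    (S.R₂.measure_Ico_ne_top hx) h (S.solvesOn_s z hx) hx.1
  simp only [sub_self, zero_mul, c₁_zero, c₂_zero, s₁_zero, s₂_zero] at this
  linear_combination this

/-! ### Conjugation by D and the swapped system -/

section Swap

variable (S)

theorem inv_D {z : ℂ} (hz : z ≠ 0) : (D z)⁻¹ = !![0, 1; -z, 0] := by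
  refine Matrix.inv_eq_right_inv ?_
  ext i j
  fin_cases i <;> fin_cases j <;> simp [D, Matrix.mul_apply, hz]

theorem inv_D_mul_mul_D {z : ℂ} (hz : z ≠ 0) (A : Matrix (Fin 2) (Fin 2) ℂ) :
    (D z)⁻¹ * A * D z = !![A 1 1, -z⁻¹ * A 1 0; -z * A 0 1, A 0 0] := by
  rw [inv_D hz, Matrix.eta_fin_two A, D, Matrix.mul_fin_two, Matrix.mul_fin_two]
  ext i j
  fin_cases i <;> fin_cases j <;> simp [mul_comm, inv_mul_cancel_left₀ hz]

/-- Interchanging the components of a solution and scaling one of them by -z solves the swapped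
system. The conjugated matrix has columns (s₂, -z s₁) and (-c₂/z, c₁), equal to the unit vectors at
0, and uniqueness identifies it. -/
theorem swap_U {z : ℂ} (hz : z ≠ 0) {x : ℝ} (hx : x ∈ interval S.b) :
    S.swap.U z x = (D z)⁻¹ * S.U z x * D z := by
  have key : S.swap.IsFundamentalMatrix z fun x => (D z)⁻¹ * S.U z x * D z := by
    refine ⟨?_, fun j => ?_⟩
    · dsimp only
      rw [inv_D_mul_mul_D hz, U_apply_zero]
      ext i j
      fin_cases i <;> fin_cases j <;> simp
    · rw [isSolution_iff]
      intro X hX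
      have hc := S.solvesOn_c z hX
      have hs := S.solvesOn_s z hX
      simp only [inv_D_mul_mul_D hz]
      fin_cases j
      · refine ⟨hs.integrable_fst.const_mul (-z), hs.integrable_snd, fun x hx => ?_, fun x hx => ?_⟩
        · change S.s₂ z x = S.s₂ z 0 + ∫ t in Ico 0 x, -z * S.s₁ z t ∂S.R₂.measure
          rw [integral_const_mul, hs.snd_eq x hx]
          ring
        · change -z * S.s₁ z x = -z * S.s₁ z 0 - z * ∫ t in Ico 0 x, S.s₂ z t ∂S.R₁.measure
          rw [hs.fst_eq x hx]
          ring
      · refine ⟨hc.integrable_fst, hc.integrable_snd.const_mul (-z⁻¹), fun x hx => ?_, fun x hx => ?_⟩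
        · change -z⁻¹ * S.c₂ z x = -z⁻¹ * S.c₂ z 0 + ∫ t in Ico 0 x, S.c₁ z t ∂S.R₂.measure
          rw [hc.snd_eq x hx]
          field_simp
          ring
        · change S.c₁ z x = S.c₁ z 0 - z * ∫ t in Ico 0 x, -z⁻¹ * S.c₂ z t ∂S.R₁.measure
          rw [integral_const_mul, hc.fst_eq x hx]
          field_simp
          ring
  exact ((S.swap.isFundamentalMatrix_iff z _).1 key hx).symm

theorem swap_c₁ {z : ℂ} (hz : z ≠ 0) {x : ℝ} (hx : x ∈ interval S.b) :
    S.swap.c₁ z x = S.s₂ z x := by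
  simp [c₁, s₂, S.swap_U hz hx, inv_D_mul_mul_D hz]

theorem swap_c₂ {z : ℂ} (hz : z ≠ 0) {x : ℝ} (hx : x ∈ interval S.b) :
    S.swap.c₂ z x = -z * S.s₁ z x := by
  simp [c₂, s₁, S.swap_U hz hx, inv_D_mul_mul_D hz]

theorem swap_s₁ {z : ℂ} (hz : z ≠ 0) {x : ℝ} (hx : x ∈ interval S.b) :
    S.swap.s₁ z x = -z⁻¹ * S.c₂ z x := by
  simp [s₁, c₂, S.swap_U hz hx, inv_D_mul_mul_D hz]

theorem swap_s₂ {z : ℂ} (hz : z ≠ 0) {x : ℝ} (hx : x ∈ interval S.b) :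
    S.swap.s₂ z x = S.c₁ z x := by
  simp [s₂, c₁, S.swap_U hz hx, inv_D_mul_mul_D hz]

end Swap

end IntegralSystem

/-! ### Monotonicity and positivity of the energy off [0, ∞) -/

theorem norm_sub_re_pos {z : ℂ} (hz : ¬ ∃ r : ℝ, 0 ≤ r ∧ z = r) : 0 < ‖z‖ - z.re := by
  by_contra h
  have h1 : ‖z‖ = z.re := le_antisymm (by linarith) (Complex.re_le_norm z)
  refine hz ⟨‖z‖, norm_nonneg z, Complex.ext (by simp [h1]) ?_⟩
  have h2 : ‖z‖ ^ 2 = z.re * z.re + z.im * z.im := by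
    rw [Complex.sq_norm, Complex.normSq_apply]
  rw [h1] at h2
  have : z.im * z.im = 0 := by linarith
  simpa using this

theorem ne_zero_of_not_nonneg {z : ℂ} (hz : ¬ ∃ r : ℝ, 0 ≤ r ∧ z = r) : z ≠ 0 := by
  rintro rfl
  exact hz ⟨0, le_rfl, by simp⟩

@[simp] theorem energy_zero_left (z v : ℂ) : energy z 0 v = 0 := by simp [energy]

@[simp] theorem energy_zero_right (z u : ℂ) : energy z u 0 = 0 := by simp [energy]

namespace SolvesOn

variable {μ ν : Measure ℝ} {z : ℂ} {u v : ℝ → ℂ} {X : ℝ}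

theorem integrable_sq_fst (h : SolvesOn μ ν z u v X) (hν : ν (Ico 0 X) ≠ ⊤) :
    IntegrableOn (fun t => ‖u t‖ ^ 2) (Ico 0 X) ν := by
  obtain ⟨C, hC0, hC⟩ := h.exists_bound
  have : IsFiniteMeasure (ν.restrict (Ico 0 X)) := ⟨by simpa using hν.lt_top⟩
  refine Integrable.of_bound (h.integrable_fst.aestronglyMeasurable.norm.pow 2) (C ^ 2) ?_
  filter_upwards [ae_restrict_mem measurableSet_Ico] with t ht
  rw [Real.norm_of_nonneg (by positivity)]
  exact pow_le_pow_left₀ (norm_nonneg _) (hC t (Ico_subset_Icc_self ht)).1 2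

theorem integrable_sq_snd (h : SolvesOn μ ν z u v X) (hμ : μ (Ico 0 X) ≠ ⊤) :
    IntegrableOn (fun t => ‖v t‖ ^ 2) (Ico 0 X) μ := by
  obtain ⟨C, hC0, hC⟩ := h.exists_bound
  have : IsFiniteMeasure (μ.restrict (Ico 0 X)) := ⟨by simpa using hμ.lt_top⟩
  refine Integrable.of_bound (h.integrable_snd.aestronglyMeasurable.norm.pow 2) (C ^ 2) ?_
  filter_upwards [ae_restrict_mem measurableSet_Ico] with t ht
  rw [Real.norm_of_nonneg (by positivity)]
  exact pow_le_pow_left₀ (norm_nonneg _) (hC t (Ico_subset_Icc_self ht)).2 2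

theorem energy_mono (h : SolvesOn μ ν z u v X) (hμ : μ (Ico 0 X) ≠ ⊤) (hν : ν (Ico 0 X) ≠ ⊤)
    (hat : ∀ t, μ {t} = 0 ∨ ν {t} = 0) {x : ℝ} (hx : x ∈ Icc 0 X) :
    energy z (u x) (v x) ≤ energy z (u X) (v X) := by
  have hs : Ico 0 x ⊆ Ico 0 X := Ico_subset_Ico_right hx.2
  have h1 := h.energy_sub hμ hν hat (hx.1.trans hx.2)
  have h2 := (h.mono hx.2).energy_sub (ne_top_of_le_ne_top hμ (measure_mono hs))
    (ne_top_of_le_ne_top hν (measure_mono hs)) hat hx.1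
  have h3 : 0 ≤ ‖z‖ - z.re := sub_nonneg.2 (Complex.re_le_norm z)
  have h4 := setIntegral_mono_set (h.integrable_sq_snd hμ) (ae_of_all _ fun t => by positivity)
    hs.eventuallyLE
  have h5 := setIntegral_mono_set (h.integrable_sq_fst hν) (ae_of_all _ fun t => by positivity)
    hs.eventuallyLE
  have h6 := mul_le_mul_of_nonneg_left
    (add_le_add h4 (mul_le_mul_of_nonneg_left h5 (norm_nonneg z))) h3
  linarith

end SolvesOn

namespace IntegralSystem

variable {S : IntegralSystem}

section Energy

variable {z : ℂ}

theorem NoCommonAtoms.energy_mono (hS : S.NoCommonAtoms) {u v : ℝ → ℂ}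
    (h : ∀ X ∈ interval S.b, SolvesOn S.R₁.measure S.R₂.measure z u v X) {x y : ℝ}
    (hx : x ∈ interval S.b) (hy : y ∈ interval S.b) (hxy : x ≤ y) :
    energy z (u x) (v x) ≤ energy z (u y) (v y) :=
  (h y hy).energy_mono (S.R₁.measure_Ico_ne_top hy) (S.R₂.measure_Ico_ne_top hy) hS ⟨hx.1, hxy⟩

theorem NoCommonAtoms.energy_sub (hS : S.NoCommonAtoms) {u v : ℝ → ℂ}
    (h : ∀ X ∈ interval S.b, SolvesOn S.R₁.measure S.R₂.measure z u v X) {x : ℝ}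
    (hx : x ∈ interval S.b) : energy z (u x) (v x) - energy z (u 0) (v 0) =
      (‖z‖ - z.re) * (∫ t in Ico 0 x, ‖v t‖ ^ 2 ∂S.R₁.measure +
        ‖z‖ * ∫ t in Ico 0 x, ‖u t‖ ^ 2 ∂S.R₂.measure) :=
  (h x hx).energy_sub (S.R₁.measure_Ico_ne_top hx) (S.R₂.measure_Ico_ne_top hx) hS hx.1

/-- If the dR₁ integral of |c₂|² vanishes, then c₁ stays equal to 1, and the dR₂ integral of |c₁|²
is R₂(x) > 0. -/
theorem NoCommonAtoms.energy_c_pos (hS : S.NoCommonAtoms) (hz : ¬ ∃ r : ℝ, 0 ≤ r ∧ z = r) {x : ℝ}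
    (hx : x ∈ interval S.b) (hR : 0 < S.R₂ x) : 0 < energy z (S.c₁ z x) (S.c₂ z x) := by
  have hδ := norm_sub_re_pos hz
  have hz0 : 0 < ‖z‖ := norm_pos_iff.2 (ne_zero_of_not_nonneg hz)
  have h := hS.energy_sub (fun X hX => S.solvesOn_c z hX) hx
  have hc := S.solvesOn_c z hx
  rw [c₂_zero, energy_zero_right, sub_zero] at h
  rw [h]
  have hA : 0 ≤ ∫ t in Ico 0 x, ‖S.c₂ z t‖ ^ 2 ∂S.R₁.measure :=
    integral_nonneg fun _ => by positivity
  have hB : 0 ≤ ∫ t in Ico 0 x, ‖S.c₁ z t‖ ^ 2 ∂S.R₂.measure :=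
    integral_nonneg fun _ => by positivity
  refine mul_pos hδ ?_
  rcases hA.lt_or_eq with hA | hA
  · have := mul_nonneg hz0.le hB
    linarith
  · rw [← hA, zero_add]
    have h0 : ∀ᵐ t ∂(S.R₁.measure.restrict (Ico 0 x)), S.c₂ z t = 0 := by
      have := (setIntegral_eq_zero_iff_of_nonneg_ae (ae_of_all _ fun t => by positivity)
        (hc.integrable_sq_snd (S.R₁.measure_Ico_ne_top hx))).1 hA.symm
      filter_upwards [this] with t ht
      simpa using ht
    have h1 : ∀ t ∈ Ico 0 x, S.c₁ z t = 1 := by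
      intro t ht
      rw [hc.fst_eq t (Ico_subset_Icc_self ht), c₁_zero, setIntegral_eq_zero_of_ae_eq_zero, add_zero]
      exact (ae_restrict_iff' measurableSet_Ico).1
        (ae_restrict_of_ae_restrict_of_subset (Ico_subset_Ico_right ht.2.le) h0)
    have h2 : ∫ t in Ico 0 x, ‖S.c₁ z t‖ ^ 2 ∂S.R₂.measure = S.R₂ x := by
      rw [setIntegral_congr_fun (g := fun _ => (1 : ℝ)) measurableSet_Ico
        (fun t ht => by simp [h1 t ht])]
      simp [S.R₂.measureReal_Ico hx]
    rw [h2]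
    positivity

theorem NoCommonAtoms.energy_s_pos (hS : S.NoCommonAtoms) (hz : ¬ ∃ r : ℝ, 0 ≤ r ∧ z = r) {x : ℝ}
    (hx : x ∈ interval S.b) (hR : 0 < S.R₁ x) : 0 < energy z (S.s₁ z x) (S.s₂ z x) := by
  have hδ := norm_sub_re_pos hz
  have hz0 : 0 < ‖z‖ := norm_pos_iff.2 (ne_zero_of_not_nonneg hz)
  have h := hS.energy_sub (fun X hX => S.solvesOn_s z hX) hx
  have hs := S.solvesOn_s z hx
  rw [s₁_zero, energy_zero_left, sub_zero] at h
  rw [h]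
  have hA : 0 ≤ ∫ t in Ico 0 x, ‖S.s₂ z t‖ ^ 2 ∂S.R₁.measure :=
    integral_nonneg fun _ => by positivity
  have hB : 0 ≤ ∫ t in Ico 0 x, ‖S.s₁ z t‖ ^ 2 ∂S.R₂.measure :=
    integral_nonneg fun _ => by positivity
  refine mul_pos hδ ?_
  rcases hB.lt_or_eq with hB | hB
  · have := mul_pos hz0 hB
    linarith
  · rw [← hB, mul_zero, add_zero]
    have h0 : ∀ᵐ t ∂(S.R₂.measure.restrict (Ico 0 x)), S.s₁ z t = 0 := by
      have := (setIntegral_eq_zero_iff_of_nonneg_ae (ae_of_all _ fun t => by positivity)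
        (hs.integrable_sq_fst (S.R₂.measure_Ico_ne_top hx))).1 hB.symm
      filter_upwards [this] with t ht
      simpa using ht
    have h1 : ∀ t ∈ Ico 0 x, S.s₂ z t = 1 := by
      intro t ht
      rw [hs.snd_eq t (Ico_subset_Icc_self ht), s₂_zero, setIntegral_eq_zero_of_ae_eq_zero, mul_zero,
        sub_zero]
      exact (ae_restrict_iff' measurableSet_Ico).1
        (ae_restrict_of_ae_restrict_of_subset (Ico_subset_Ico_right ht.2.le) h0)
    have h2 : ∫ t in Ico 0 x, ‖S.s₂ z t‖ ^ 2 ∂S.R₁.measure = S.R₁ x := by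
      rw [setIntegral_congr_fun (g := fun _ => (1 : ℝ)) measurableSet_Ico
        (fun t ht => by simp [h1 t ht])]
      simp [S.R₁.measureReal_Ico hx]
    rw [h2]
    exact hR

/-- The energy identity turns an upper bound on the energy into bounds, uniform in x, on both
nonnegative integrals. -/
theorem NoCommonAtoms.memLp_of_energy_le (hS : S.NoCommonAtoms) (hz : ¬ ∃ r : ℝ, 0 ≤ r ∧ z = r)
    {u v : ℝ → ℂ} (h : ∀ X ∈ interval S.b, SolvesOn S.R₁.measure S.R₂.measure z u v X) {C : ℝ}
    (hC : ∀ x ∈ interval S.b, energy z (u x) (v x) ≤ C) :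
    MemLp u 2 S.R₂.measure ∧ MemLp v 2 S.R₁.measure := by
  have hδ := norm_sub_re_pos hz
  have hz0 : 0 < ‖z‖ := norm_pos_iff.2 (ne_zero_of_not_nonneg hz)
  set K := (C - energy z (u 0) (v 0)) / (‖z‖ - z.re) with hK
  have hle : ∀ x ∈ interval S.b, ∫ t in Ico 0 x, ‖v t‖ ^ 2 ∂S.R₁.measure +
      ‖z‖ * ∫ t in Ico 0 x, ‖u t‖ ^ 2 ∂S.R₂.measure ≤ K := by
    intro x hx
    rw [hK, le_div_iff₀ hδ, mul_comm, ← hS.energy_sub h hx]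
    linarith [hC x hx]
  have hA : ∀ x, 0 ≤ ∫ t in Ico 0 x, ‖v t‖ ^ 2 ∂S.R₁.measure := fun x =>
    integral_nonneg fun _ => by positivity
  have hB : ∀ x, 0 ≤ ∫ t in Ico 0 x, ‖u t‖ ^ 2 ∂S.R₂.measure := fun x =>
    integral_nonneg fun _ => by positivity
  constructor
  · refine S.R₂.memLp_two_of_integral_le S.b_pos (C := K / ‖z‖)
      (fun x hx => (h x hx).integrable_fst.aestronglyMeasurable)
      (fun x hx => (h x hx).integrable_sq_fst (S.R₂.measure_Ico_ne_top hx)) (fun x hx => ?_)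
    rw [le_div_iff₀ hz0, mul_comm]
    linarith [hle x hx, hA x]
  · refine S.R₁.memLp_two_of_integral_le S.b_pos (C := K)
      (fun x hx => (h x hx).integrable_snd.aestronglyMeasurable)
      (fun x hx => (h x hx).integrable_sq_snd (S.R₁.measure_Ico_ne_top hx)) (fun x hx => ?_)
    linarith [hle x hx, mul_nonneg hz0.le (hB x)]

end Energy

/-! ### Square integrability of all solutions is independent of the parameter -/

section Transfer

variable (S) in
/-- All solutions for the parameter `z` have a first component in `𝓛²(R₂)`. -/
def AllL2 (z : ℂ) : Prop := MemLp (S.c₁ z) 2 S.R₂.measure ∧ MemLp (S.s₁ z) 2 S.R₂.measure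

/-- Variation of constants. A solution for z is a combination of c and s for z₀ whose coefficients
are Wronskians; their growth is governed by the finite measure |z - z₀| g² dR₂, so Grönwall keeps
them bounded and u is dominated by g. -/
theorem AllL2.memLp {z₀ z : ℂ} (hL : S.AllL2 z₀) (hS : S.NoCommonAtoms) {u v : ℝ → ℂ}
    (h : ∀ X ∈ interval S.b, SolvesOn S.R₁.measure S.R₂.measure z u v X) :
    MemLp u 2 S.R₂.measure := by
  set c₁ := S.c₁ z₀ with hc₁
  set c₂ := S.c₂ z₀ with hc₂
  set s₁ := S.s₁ z₀ with hs₁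
  set s₂ := S.s₂ z₀ with hs₂
  set g : ℝ → ℝ := fun t => ‖c₁ t‖ + ‖s₁ t‖ with hg
  set a : ℝ → ℂ := fun x => u x * s₂ x - v x * s₁ x with ha
  set d : ℝ → ℂ := fun x => u x * c₂ x - v x * c₁ x with hd
  set φ : ℝ → ENNReal := fun x => ‖a x‖ₑ + ‖d x‖ₑ with hφ
  -- The factor 2 arises because φ adds two Wronskians, each growing at most by |z - z₀| ∫ φ g² dR₂.
  set w : ℝ → ENNReal := fun t => 2 * ‖z - z₀‖ₑ * ‖g t ^ 2‖ₑ with hw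
  have hgL : MemLp g 2 S.R₂.measure := hL.1.norm.add hL.2.norm
  have hg2 : Integrable (fun t => g t ^ 2) S.R₂.measure := hgL.integrable_sq
  have hg0 : ∀ t, 0 ≤ g t := fun t => add_nonneg (norm_nonneg _) (norm_nonneg _)
  have hge : ∀ t, ‖g t‖ₑ = ‖c₁ t‖ₑ + ‖s₁ t‖ₑ := fun t => by
    rw [Real.enorm_of_nonneg (hg0 t), ← ofReal_norm, ← ofReal_norm,
      ENNReal.ofReal_add (norm_nonneg _) (norm_nonneg _)]
  have hwm : AEMeasurable w S.R₂.measure := hg2.aestronglyMeasurable.enorm.const_mul _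
  set ρ := S.R₂.measure.withDensity w with hρ
  have hρ_fin : ρ univ ≠ ⊤ := by
    rw [hρ, withDensity_apply _ MeasurableSet.univ, Measure.restrict_univ, hw,
      lintegral_const_mul'' _ hg2.aestronglyMeasurable.enorm]
    exact ENNReal.mul_ne_top (ENNReal.mul_ne_top (by simp) (by simp)) hg2.2.ne
  have hu_eq : ∀ x ∈ interval S.b, u x = a x * c₁ x - d x * s₁ x := by
    intro x hx
    have := hS.wronskian z₀ hx
    simp only [ha, hd]
    linear_combination (-u x) * this
  have hu_le : ∀ x ∈ interval S.b, ‖u x‖ₑ ≤ φ x * ‖g x‖ₑ := by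
    intro x hx
    rw [hu_eq x hx, hge, hφ]
    refine (enorm_sub_le).trans ?_
    rw [enorm_mul, enorm_mul]
    rw [add_mul]
    exact add_le_add (mul_le_mul' le_rfl le_self_add) (mul_le_mul' le_rfl le_add_self)
  have hwr : ∀ {p r : ℝ → ℂ}, (∀ X ∈ interval S.b,
      SolvesOn S.R₁.measure S.R₂.measure z₀ p r X) → (∀ t, ‖p t‖ₑ ≤ ‖g t‖ₑ) →
      ∀ x ∈ interval S.b, ‖u x * r x - v x * p x‖ₑ ≤ ‖u 0 * r 0 - v 0 * p 0‖ₑ +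
        ‖z - z₀‖ₑ * ∫⁻ t in Ico 0 x, φ t * ‖g t ^ 2‖ₑ ∂S.R₂.measure := by
    intro p r hp hpg x hx
    have hW := (h x hx).wronskian_sub (S.R₁.measure_Ico_ne_top hx)
      (S.R₂.measure_Ico_ne_top hx) hS (hp x hx) hx.1
    rw [sub_eq_iff_eq_add'] at hW
    rw [hW]
    refine (enorm_add_le _ _).trans (add_le_add le_rfl ?_)
    rw [enorm_mul]
    refine mul_le_mul' le_rfl ((enorm_integral_le_lintegral_enorm _).trans ?_)
    refine setLIntegral_mono' measurableSet_Ico fun t ht => ?_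
    rw [enorm_mul, enorm_pow, pow_two, ← mul_assoc]
    exact mul_le_mul' (hu_le t (mem_interval_of_le hx ht.1 ht.2.le)) (hpg t)
  have hφ_le : ∀ x ∈ interval S.b, φ x ≤ φ 0 + ∫⁻ t in Ico 0 x, φ t ∂ρ := by
    intro x hx
    have h1 := hwr (fun X hX => S.solvesOn_s z₀ hX) (fun t => by rw [hge]; exact le_add_self) x hx
    have h2 := hwr (fun X hX => S.solvesOn_c z₀ hX) (fun t => by rw [hge]; exact le_self_add) x hx
    refine (add_le_add h1 h2).trans_eq ?_
    rw [hρ, setLIntegral_withDensity_eq_setLIntegral_mul_non_measurable₀ _ hwm.restrict _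
      measurableSet_Ico (ae_of_all _ fun t => by simp [hw, ENNReal.mul_lt_top_iff])]
    have : ∫⁻ t in Ico 0 x, (w * φ) t ∂S.R₂.measure =
        (2 * ‖z - z₀‖ₑ) * ∫⁻ t in Ico 0 x, φ t * ‖g t ^ 2‖ₑ ∂S.R₂.measure := by
      rw [← lintegral_const_mul' _ _ (ENNReal.mul_ne_top (by simp) (by simp))]
      refine lintegral_congr fun t => ?_
      simp only [Pi.mul_apply, hw]
      ring
    rw [this]
    simp only [hφ, ha, hd]
    ring
  have hφ_bd : ∀ X ∈ interval S.b, ∃ B : ENNReal, B ≠ ⊤ ∧ ∀ x ∈ Icc 0 X, φ x ≤ B := by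
    intro X hX
    obtain ⟨C, hC0, hC⟩ := (h X hX).exists_bound
    obtain ⟨C', hC0', hC'⟩ := (S.solvesOn_c z₀ hX).exists_bound
    obtain ⟨C'', hC0'', hC''⟩ := (S.solvesOn_s z₀ hX).exists_bound
    refine ⟨ENNReal.ofReal (C * C'' + C * C'') + ENNReal.ofReal (C * C' + C * C'), by simp,
      fun x hx => ?_⟩
    simp only [hφ]
    rw [← ofReal_norm, ← ofReal_norm]
    have hb := hC x hx
    have hb' := hC' x hx
    have hb'' := hC'' x hx
    refine add_le_add (ENNReal.ofReal_le_ofReal ?_) (ENNReal.ofReal_le_ofReal ?_)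
    · refine (norm_sub_le _ _).trans ?_
      rw [norm_mul, norm_mul]
      exact add_le_add (mul_le_mul hb.1 hb''.2 (norm_nonneg _) hC0)
        (mul_le_mul hb.2 hb''.1 (norm_nonneg _) hC0)
    · refine (norm_sub_le _ _).trans ?_
      rw [norm_mul, norm_mul]
      exact add_le_add (mul_le_mul hb.1 hb'.2 (norm_nonneg _) hC0)
        (mul_le_mul hb.2 hb'.1 (norm_nonneg _) hC0)
  set K : ENNReal := φ 0 * ENNReal.ofReal (Real.exp (ρ.real univ)) with hK
  have hKtop : K ≠ ⊤ := ENNReal.mul_ne_top (by simp [hφ]) ENNReal.ofReal_ne_top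
  have hφK : ∀ x ∈ interval S.b, φ x ≤ K := by
    intro x hx
    obtain ⟨B, hB, hBx⟩ := hφ_bd x hx
    refine (gronwall_Ico ρ hx.1 (ne_top_of_le_ne_top hρ_fin (measure_mono (subset_univ _))) hB hBx
      fun t ht => hφ_le t (mem_interval_of_mem_Icc hx ht)).trans ?_
    rw [hK]
    exact mul_le_mul' le_rfl (ENNReal.ofReal_le_ofReal
      (Real.exp_le_exp.2 (measureReal_mono (subset_univ _) hρ_fin)))
  refine hgL.of_le_mul (c := K.toReal) (S.R₂.aestronglyMeasurable_of_restrict S.b_pos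
    fun x hx => (h x hx).integrable_fst.aestronglyMeasurable) ?_
  filter_upwards [S.R₂.ae_mem_interval] with x hx
  have h1 := (hu_le x hx).trans (mul_le_mul' (hφK x hx) le_rfl)
  rw [← ENNReal.ofReal_toReal hKtop, ← ofReal_norm, ← ofReal_norm,
    ← ENNReal.ofReal_mul ENNReal.toReal_nonneg] at h1
  exact (ENNReal.ofReal_le_ofReal_iff (mul_nonneg ENNReal.toReal_nonneg (norm_nonneg _))).1 h1

theorem AllL2.of_ne {z₀ : ℂ} (hL : S.AllL2 z₀) (hS : S.NoCommonAtoms) (z : ℂ) : S.AllL2 z :=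
  ⟨hL.memLp hS fun _ hX => S.solvesOn_c z hX, hL.memLp hS fun _ hX => S.solvesOn_s z hX⟩

theorem c₂_param_zero {x : ℝ} (hx : x ∈ interval S.b) : S.c₂ 0 x = 0 := by
  rw [(S.solvesOn_c 0 hx).snd_eq x ⟨hx.1, le_rfl⟩]; simp

theorem s₂_param_zero {x : ℝ} (hx : x ∈ interval S.b) : S.s₂ 0 x = 1 := by
  rw [(S.solvesOn_s 0 hx).snd_eq x ⟨hx.1, le_rfl⟩]; simp

theorem c₁_param_zero {x : ℝ} (hx : x ∈ interval S.b) : S.c₁ 0 x = 1 := by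
  rw [(S.solvesOn_c 0 hx).fst_eq x ⟨hx.1, le_rfl⟩, setIntegral_eq_zero_of_forall_eq_zero]
  · simp
  · exact fun t ht => c₂_param_zero (mem_interval_of_le hx ht.1 ht.2.le)

/-- At parameter 0 the first column is the constant (1, 0), so the constant 1 is square integrable
and dR₂ is finite. -/
theorem AllL2.bounded {z : ℂ} (hL : S.AllL2 z) (hS : S.NoCommonAtoms) : S.R₂.Bounded := by
  refine S.R₂.bounded_of_measure_ne_top ?_
  have h1 : MemLp (fun _ : ℝ => (1 : ℂ)) 2 S.R₂.measure := by
    refine (hL.of_ne hS 0).1.ae_eq ?_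
    filter_upwards [S.R₂.ae_mem_interval] with x hx
    exact c₁_param_zero hx
  exact (((memLp_const_iff (by simp) (by simp)).1 h1).resolve_left one_ne_zero).ne

end Transfer

end IntegralSystem

/-! ### Nested Weyl discs and the Weyl solution -/

theorem continuous_energy_sub_mul (z c₁ c₂ s₁ s₂ : ℂ) :
    Continuous fun m => energy z (s₁ - m * c₁) (s₂ - m * c₂) := by
  unfold energy
  exact Complex.continuous_re.comp (continuous_const.mul ((by fun_prop : Continuous _).mul
    (Complex.continuous_conj.comp (by fun_prop))))

theorem ne_zero_of_energy_pos {z u v : ℂ} (h : 0 < energy z u v) : u ≠ 0 ∧ v ≠ 0 := by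
  constructor
  · rintro rfl
    simp at h
  · rintro rfl
    simp at h

theorem not_nonneg_of_im_ne_zero {z : ℂ} (hz : z.im ≠ 0) : ¬ ∃ r : ℝ, 0 ≤ r ∧ z = r := by
  rintro ⟨r, -, rfl⟩
  exact hz (Complex.ofReal_im r)

namespace IntegralSystem

variable {S : IntegralSystem} {z : ℂ}

/-- The intersection of the nested Weyl discs is nonempty. -/
theorem NoCommonAtoms.exists_energy_nonpos (hS : S.NoCommonAtoms) (hN : S.Nondegenerate)
    (hz : ¬ ∃ r : ℝ, 0 ≤ r ∧ z = r) : ∃ q : ℂ, ∀ x ∈ interval S.b,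
      energy z (S.s₁ z x - q * S.c₁ z x) (S.s₂ z x - q * S.c₂ z x) ≤ 0 := by
  obtain ⟨x₀, hx₀, h1, h2⟩ := hN
  obtain ⟨y, hy, hmono, hlim⟩ := exists_seq_interval S.b_pos
  -- Starting at x₀ makes the energy of c positive from the outset, so every disc in the sequence is
  -- bounded.
  set p : ℕ → ℝ := fun n => max x₀ (y n) with hp
  have hpm : ∀ n, p n ∈ interval S.b := fun n => by
    rcases max_cases x₀ (y n) with h | h
    · simp only [hp, h.1]; exact hx₀
    · simp only [hp, h.1]; exact hy n
  have hpmono : Monotone p := fun m n h => max_le_max le_rfl (hmono h)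
  have hpos : ∀ n, 0 < energy z (S.c₁ z (p n)) (S.c₂ z (p n)) := fun n =>
    hS.energy_c_pos hz (hpm n) (h2.trans_le (S.R₂.mono hx₀ (hpm n) (le_max_left _ _)))
  set K : ℕ → Set ℂ := fun n => {m | energy z (S.s₁ z (p n) - m * S.c₁ z (p n))
    (S.s₂ z (p n) - m * S.c₂ z (p n)) ≤ 0} with hK
  have hnest : ∀ m, ∀ {x x'}, x ∈ interval S.b → x' ∈ interval S.b → x ≤ x' →
      energy z (S.s₁ z x - m * S.c₁ z x) (S.s₂ z x - m * S.c₂ z x) ≤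
        energy z (S.s₁ z x' - m * S.c₁ z x') (S.s₂ z x' - m * S.c₂ z x') := fun m x x' hx hx' h =>
    hS.energy_mono (fun X hX => S.solvesOn_sub_mul z m hX) hx hx' h
  -- For this m the first component of s - m c vanishes, hence so does the energy.
  have hmem : ∀ n, S.s₁ z (p n) / S.c₁ z (p n) ∈ K n := fun n => by
    simp [hK, div_mul_cancel₀ _ (ne_zero_of_energy_pos (hpos n)).1]
  have hclosed : ∀ n, IsClosed (K n) := fun n =>
    isClosed_le (continuous_energy_sub_mul _ _ _ _ _) continuous_const
  have hcpt : IsCompact (K 0) := by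
    refine (isCompact_closedBall (S.s₁ z (p 0) / S.c₁ z (p 0))
      (‖(‖z‖ : ℂ) - z‖ / energy z (S.c₁ z (p 0)) (S.c₂ z (p 0)))).of_isClosed_subset (hclosed 0)
      fun m hm => ?_
    rw [mem_closedBall_iff_norm, le_div_iff₀ (hpos 0)]
    exact norm_mul_energy_le (hS.wronskian z (hpm 0)) (hpos 0) hm (hmem 0)
  obtain ⟨q, hq⟩ := IsCompact.nonempty_iInter_of_sequence_nonempty_isCompact_isClosed K
    (fun n m hm => (hnest m (hpm n) (hpm (n + 1)) (hpmono n.le_succ)).trans hm)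
    (fun n => ⟨_, hmem n⟩) hcpt hclosed
  refine ⟨q, fun x hx => ?_⟩
  obtain ⟨n, hn⟩ := (hlim x hx).exists
  exact (hnest q hx (hpm n) (hn.le.trans (le_max_right _ _))).trans (mem_iInter.1 hq n)

theorem not_allL2_and_allL2_swap (hS : S.NoCommonAtoms) (hsing : S.Singular) :
    ¬ (S.AllL2 z ∧ S.swap.AllL2 z) :=
  fun h => hsing ⟨h.2.bounded hS.swap, h.1.bounded hS⟩

/-- Otherwise c and s - q c both have bounded energy, so all solutions are square integrable for the
system and for its swap; this bounds R₂ and R₁, against singularity. -/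
theorem NoCommonAtoms.eventually_lt_energy (hS : S.NoCommonAtoms) (hN : S.Nondegenerate)
    (hsing : S.Singular) (hz : ¬ ∃ r : ℝ, 0 ≤ r ∧ z = r) (C : ℝ) :
    ∀ᶠ x in endFilter S.b, C < energy z (S.c₁ z x) (S.c₂ z x) := by
  rw [eventually_endFilter S.b_pos]
  by_contra! hcon
  have hle : ∀ x ∈ interval S.b, energy z (S.c₁ z x) (S.c₂ z x) ≤ C := by
    intro x hx
    obtain ⟨y, hy, hxy, h⟩ := hcon x hx
    exact (hS.energy_mono (fun X hX => S.solvesOn_c z hX) hx hy hxy).trans h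
  obtain ⟨q, hq⟩ := hS.exists_energy_nonpos hN hz
  obtain ⟨a1, a2⟩ := hS.memLp_of_energy_le hz (fun X hX => S.solvesOn_c z hX) hle
  obtain ⟨b1, b2⟩ := hS.memLp_of_energy_le hz (fun X hX => S.solvesOn_sub_mul z q hX) hq
  have hz0 := ne_zero_of_not_nonneg hz
  have d1 : MemLp (S.s₁ z) 2 S.R₂.measure := by
    refine (b1.add (a1.const_mul q)).ae_eq (ae_of_all _ fun t => ?_)
    simp
  have d2 : MemLp (S.s₂ z) 2 S.R₁.measure := by
    refine (b2.add (a2.const_mul q)).ae_eq (ae_of_all _ fun t => ?_)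
    simp
  refine not_allL2_and_allL2_swap (z := z) hS hsing ⟨⟨a1, d1⟩, d2.ae_eq ?_,
    (a2.const_mul (-z⁻¹)).ae_eq ?_⟩
  · filter_upwards [S.R₁.ae_mem_interval] with x hx
    rw [S.swap_c₁ hz0 hx]
  · filter_upwards [S.R₁.ae_mem_interval] with x hx
    rw [S.swap_s₁ hz0 hx]

/-- The Weyl solution of a singular system. -/
theorem NoCommonAtoms.exists_weyl (hS : S.NoCommonAtoms) (hN : S.Nondegenerate)
    (hsing : S.Singular) (hz : ¬ ∃ r : ℝ, 0 ≤ r ∧ z = r) : ∃ q : ℂ, q ≠ 0 ∧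
      Tendsto (fun x => S.s₁ z x / S.c₁ z x) (endFilter S.b) (𝓝 q) ∧
      Tendsto (fun x => S.s₂ z x / S.c₂ z x) (endFilter S.b) (𝓝 q) ∧
      MemLp (fun x => S.s₁ z x - q * S.c₁ z x) 2 S.R₂.measure := by
  obtain ⟨q, hq⟩ := hS.exists_energy_nonpos hN hz
  -- Any choice of a point m x in the disc at x converges to q, as the diameters tend to 0.
  have hlim : ∀ m : ℝ → ℂ, (∀ x, S.c₁ z x ≠ 0 → S.c₂ z x ≠ 0 →
      energy z (S.s₁ z x - m x * S.c₁ z x) (S.s₂ z x - m x * S.c₂ z x) ≤ 0) →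
      Tendsto m (endFilter S.b) (𝓝 q) := by
    intro m hm
    rw [Metric.tendsto_nhds]
    intro ε hε
    filter_upwards [eventually_mem_interval S.b_pos,
      hS.eventually_lt_energy hN hsing hz (‖(‖z‖ : ℂ) - z‖ / ε)] with x hx hx'
    have hpos : 0 < energy z (S.c₁ z x) (S.c₂ z x) := lt_of_le_of_lt (by positivity) hx'
    obtain ⟨h1, h2⟩ := ne_zero_of_energy_pos hpos
    have h3 := norm_mul_energy_le (hS.wronskian z hx) hpos (hm x h1 h2) (hq x hx)
    rw [div_lt_iff₀ hε, mul_comm] at hx'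
    rw [dist_eq_norm]
    exact lt_of_mul_lt_mul_right (h3.trans_lt hx') hpos.le
  refine ⟨q, ?_, hlim _ fun x h1 h2 => ?_, hlim _ fun x h1 h2 => ?_,
    (hS.memLp_of_energy_le hz (fun X hX => S.solvesOn_sub_mul z q hX) hq).1⟩
  -- For q = 0 the column s itself would have nonpositive energy, although its energy is positive
  -- once R₁ is.
  · rintro rfl
    obtain ⟨x, hx, h1, h2⟩ := hN
    have := hq x hx
    simp only [zero_mul, sub_zero] at this
    exact (hS.energy_s_pos hz hx h1).not_ge this
  · simp [div_mul_cancel₀ _ h1]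
  · simp [div_mul_cancel₀ _ h2]

/-! ### Limit point and limit circle as dimensions -/

section DefectSpace

theorem indicator_mem_defectSpace {u : ℝ → Fin 2 → ℂ} (hu : S.IsSolution z u)
    (hL : MemLp (fun t => u t 0) 2 S.R₂.measure) :
    (interval S.b).indicator u ∈ S.defectSpace z := by
  have hE : EqOn u ((interval S.b).indicator u) (interval S.b) := fun x hx =>
    (indicator_of_mem hx u).symm
  refine ⟨hu.congr hE, fun x hx => indicator_of_notMem hx u, hL.ae_eq ?_⟩
  filter_upwards [S.R₂.ae_mem_interval] with x hx
  rw [← hE hx]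

variable (S z) in
/-- The initial value of a solution. -/
def initialValue : S.defectSpace z →ₗ[ℂ] (Fin 2 → ℂ) where
  toFun u := u.1 0
  map_add' _ _ := rfl
  map_smul' _ _ := rfl

theorem initialValue_injective : Function.Injective (S.initialValue z) := by
  rintro ⟨u, hu, hu0, _⟩ ⟨v, hv, hv0, _⟩ h
  refine Subtype.ext (funext fun x => ?_)
  by_cases hx : x ∈ interval S.b
  · exact hu.eqOn hv h hx
  · exact (hu0 x hx).trans (hv0 x hx).symm

/-- The initial value map is injective by uniqueness, and here every initial value gives a square
integrable solution. -/
theorem AllL2.finrank_defectSpace (hL : S.AllL2 z) (hS : S.NoCommonAtoms) :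
    Module.finrank ℂ (S.defectSpace z) = 2 := by
  have hsurj : Function.Surjective (S.initialValue z) := by
    intro u₀
    obtain ⟨u, hu0, hu⟩ := S.exists_isSolution z u₀
    refine ⟨⟨_, indicator_mem_defectSpace hu (hL.memLp hS (S.isSolution_iff.1 hu))⟩, ?_⟩
    change (interval S.b).indicator u 0 = u₀
    rw [indicator_of_mem (zero_mem_interval S.b_pos), hu0]
  rw [(LinearEquiv.ofBijective _ ⟨initialValue_injective, hsurj⟩).finrank_eq]
  simp

/-- The Weyl solution, whose second component is 1 at 0, excludes dimension 0. Dimension 2 would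
make the initial value map onto and so put both columns in L². -/
theorem finrank_defectSpace_eq_one (hL : ¬ S.AllL2 z) {q : ℂ}
    (hq : MemLp (fun x => S.s₁ z x - q * S.c₁ z x) 2 S.R₂.measure) :
    Module.finrank ℂ (S.defectSpace z) = 1 := by
  have hfin : Module.Finite ℂ (S.defectSpace z) :=
    Module.Finite.of_injective (S.initialValue z) initialValue_injective
  have hle : Module.finrank ℂ (S.defectSpace z) ≤ 2 := by
    have := LinearMap.finrank_le_finrank_of_injective (initialValue_injective (S := S) (z := z))
    simpa using this
  have hpos : Module.finrank ℂ (S.defectSpace z) ≠ 0 := by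
    have hsol : S.IsSolution z
        (fun x => ![S.s₁ z x - q * S.c₁ z x, S.s₂ z x - q * S.c₂ z x]) :=
      S.isSolution_iff.2 fun X hX => S.solvesOn_sub_mul z q hX
    refine (Module.finrank_pos_iff_exists_ne_zero.2
      ⟨⟨_, indicator_mem_defectSpace hsol hq⟩, fun h => ?_⟩).ne'
    have h0 := congrFun (congrFun (Subtype.ext_iff.1 h) 0) 1
    simp [indicator_of_mem (zero_mem_interval S.b_pos)] at h0
  have hne : Module.finrank ℂ (S.defectSpace z) ≠ 2 := by
    intro h2
    have hsurj : Function.Surjective (S.initialValue z) :=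
      (LinearMap.injective_iff_surjective_of_finrank_eq_finrank (by simp [h2])).1
        initialValue_injective
    have key : ∀ {u : ℝ → Fin 2 → ℂ}, S.IsSolution z u → MemLp (fun t => u t 0) 2 S.R₂.measure := by
      intro u hu
      obtain ⟨⟨v, hv, _, hvL⟩, hv0⟩ := hsurj (u 0)
      have hE := hv.eqOn hu hv0
      refine hvL.ae_eq ?_
      filter_upwards [S.R₂.ae_mem_interval] with x hx
      rw [hE hx]
    exact hL ⟨key (u := fun x i => S.U z x i 0) ((S.isFundamentalMatrix_U z).2 0),
      key (u := fun x i => S.U z x i 1) ((S.isFundamentalMatrix_U z).2 1)⟩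
  omega

theorem AllL2.limitCircle (hL : S.AllL2 z) (hS : S.NoCommonAtoms) : S.LimitCircle :=
  fun w _ => (hL.of_ne hS w).finrank_defectSpace hS

theorem limitPoint_of_not_allL2 (hL : ¬ S.AllL2 z) (hS : S.NoCommonAtoms) (hN : S.Nondegenerate)
    (hsing : S.Singular) : S.LimitPoint := by
  intro w hw
  obtain ⟨q, -, -, -, hq⟩ := hS.exists_weyl hN hsing (not_nonneg_of_im_ne_zero hw)
  exact finrank_defectSpace_eq_one (fun h => hL (h.of_ne hS z)) hq

theorem not_limitCircle_and_limitPoint : ¬ (S.LimitCircle ∧ S.LimitPoint) := by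
  rintro ⟨h1, h2⟩
  have := (h1 Complex.I (by simp)).symm.trans (h2 Complex.I (by simp))
  omega

end DefectSpace

/-! ### The Neumann m-function of a singular system -/

/-- In the limit circle case `u₂` and `u₁ - R₁ u₂` converge at the right endpoint. -/
theorem AllL2.exists_tendsto {z₀ : ℂ} (hL : S.AllL2 z₀) (hS : S.NoCommonAtoms) {u v : ℝ → ℂ}
    (h : ∀ X ∈ interval S.b, SolvesOn S.R₁.measure S.R₂.measure z u v X) :
    (∃ l, Tendsto v (endFilter S.b) (𝓝 l)) ∧
      ∃ l, Tendsto (fun x => u x - v x * S.s₁ 0 x) (endFilter S.b) (𝓝 l) := by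
  have hu := hL.memLp hS h
  -- At parameter 0 the columns are (1, 0) and (R₁, 1). Wronskians with them give -v and u - R₁ v,
  -- and they converge because u p is integrable as a product of two L² functions.
  have h0 := hL.of_ne hS 0
  have hconv : ∀ {p r : ℝ → ℂ}, MemLp p 2 S.R₂.measure → (∀ X ∈ interval S.b,
      SolvesOn S.R₁.measure S.R₂.measure 0 p r X) →
      ∃ l, Tendsto (fun x => u x * r x - v x * p x) (endFilter S.b) (𝓝 l) := by
    intro p r hpL hp
    have hint : Integrable (fun t => u t * p t) S.R₂.measure := hu.integrable_mul hpL
    refine ⟨_, (((tendsto_integral_endFilter S.b_pos hint.integrableOn).const_mul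
      (z - 0)).const_add (u 0 * r 0 - v 0 * p 0)).congr' ?_⟩
    filter_upwards [eventually_mem_interval S.b_pos] with x hx
    rw [← (h x hx).wronskian_sub (S.R₁.measure_Ico_ne_top hx)
      (S.R₂.measure_Ico_ne_top hx) hS (hp x hx) hx.1]
    ring
  constructor
  · obtain ⟨l, hl⟩ := hconv h0.1 fun X hX => S.solvesOn_c 0 hX
    refine ⟨-l, hl.neg.congr' ?_⟩
    filter_upwards [eventually_mem_interval S.b_pos] with x hx
    rw [c₂_param_zero hx, c₁_param_zero hx]
    ring
  · obtain ⟨l, hl⟩ := hconv h0.2 fun X hX => S.solvesOn_s 0 hX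
    refine ⟨l, hl.congr' ?_⟩
    filter_upwards [eventually_mem_interval S.b_pos] with x hx
    rw [s₂_param_zero hx, mul_one]

/-- In the limit circle case the boundary values of s₂ and c₂ exist with ratio q. In the limit point
case a second admissible number would put c₁, and then s₁, in L². -/
theorem isNeumann_iff (hS : S.NoCommonAtoms) (hN : S.Nondegenerate) (hsing : S.Singular)
    (hz : ¬ ∃ r : ℝ, 0 ≤ r ∧ z = r) {q : ℂ}
    (hq : Tendsto (fun x => S.s₂ z x / S.c₂ z x) (endFilter S.b) (𝓝 q))
    (hL2 : MemLp (fun x => S.s₁ z x - q * S.c₁ z x) 2 S.R₂.measure) (w : ℂ) :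
    S.IsNeumann z w ↔ w = q := by
  have hbot := endFilter_neBot S.b_pos
  by_cases hL : S.AllL2 z
  · have hLC := hL.limitCircle hS
    have hLP : ¬ S.LimitPoint := fun h => not_limitCircle_and_limitPoint ⟨hLC, h⟩
    obtain ⟨⟨C, hC⟩, A, hA⟩ := hL.exists_tendsto hS fun X hX => S.solvesOn_c z hX
    obtain ⟨⟨D, hD⟩, B, hB⟩ := hL.exists_tendsto hS fun X hX => S.solvesOn_s z hX
    -- The Wronskian is unchanged when u₁ is replaced by u₁ - R₁ u₂, so it passes to the limit even
    -- if R₁ is unbounded. It prevents C and D from vanishing together, whence C ≠ 0.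
    have hdet : A * D - B * C = 1 := by
      refine tendsto_nhds_unique ((hA.mul hD).sub (hB.mul hC)) (tendsto_const_nhds.congr' ?_)
      filter_upwards [eventually_mem_interval S.b_pos] with x hx
      rw [← hS.wronskian z hx]
      ring
    have hDq : D = q * C := by
      refine tendsto_nhds_unique hD ((hq.mul hC).congr' ?_)
      filter_upwards [hS.eventually_lt_energy hN hsing hz 0] with x hx
      rw [div_mul_cancel₀ _ (ne_zero_of_energy_pos hx).2]
    have hC0 : C ≠ 0 := by
      rintro rfl
      simp [hDq] at hdet
    have hlim : Tendsto (fun x => S.s₂ z x - w * S.c₂ z x) (endFilter S.b) (𝓝 (D - w * C)) :=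
      hD.sub (hC.const_mul w)
    have : S.IsNeumann z w ↔ D - w * C = 0 := by
      unfold IsNeumann
      simp only [hLC, hLP, true_and, false_and, or_false]
      exact ⟨fun h => tendsto_nhds_unique hlim h, fun h => h ▸ hlim⟩
    rw [this, hDq, ← sub_mul, mul_eq_zero, or_iff_left hC0, sub_eq_zero, eq_comm]
  · have hLP := limitPoint_of_not_allL2 hL hS hN hsing
    have hLC : ¬ S.LimitCircle := fun h => not_limitCircle_and_limitPoint ⟨h, hLP⟩
    unfold IsNeumann
    simp only [hLC, hLP, true_and, false_and, false_or]
    refine ⟨fun h => ?_, fun h => h ▸ hL2⟩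
    by_contra hne
    have hne' : q - w ≠ 0 := sub_ne_zero.2 (Ne.symm hne)
    have hc : MemLp (S.c₁ z) 2 S.R₂.measure := by
      refine ((h.sub hL2).const_mul (q - w)⁻¹).ae_eq (ae_of_all _ fun t => ?_)
      simp only [Pi.sub_apply]
      field_simp
      ring
    refine hL ⟨hc, (hL2.add (hc.const_mul q)).ae_eq (ae_of_all _ fun t => ?_)⟩
    simp

/-- The Weyl coefficients of a singular system and of its dual. -/
theorem exists_weyl_coefficient (hS : S.NoCommonAtoms) (hN : S.Nondegenerate) (hsing : S.Singular)
    (hz : ¬ ∃ r : ℝ, 0 ≤ r ∧ z = r) : ∃ q : ℂ, q ≠ 0 ∧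
      S.IsPrincipal z q ∧ S.swap.IsPrincipal z (-1 / (z * q)) ∧
      (∀ w, S.IsNeumann z w ↔ w = q) ∧ (∀ w, S.swap.IsNeumann z w ↔ w = -1 / (z * q)) := by
  have hbot := endFilter_neBot S.swap.b_pos
  have hz0 := ne_zero_of_not_nonneg hz
  obtain ⟨q, hq0, h1, h2, h3⟩ := hS.exists_weyl hN hsing hz
  obtain ⟨p, -, k1, k2, k3⟩ := hS.swap.exists_weyl hN.swap hsing.swap hz
  -- The swapped quotient ŝ₁/ĉ₁ equals -c₂/(z s₂), the reciprocal of the second convergent quotient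
  -- s₂/c₂ up to the factor -1/z.
  have hp : p = -1 / (z * q) := by
    refine tendsto_nhds_unique k1 (((h2.inv₀ hq0).const_mul (-z⁻¹)).congr' ?_ |>.trans_eq ?_)
    · filter_upwards [eventually_mem_interval S.b_pos] with x hx
      rw [S.swap_s₁ hz0 hx, S.swap_c₁ hz0 hx, inv_div, mul_div_assoc]
    · congr 1
      field_simp
  subst hp
  exact ⟨q, hq0, h1, k1, isNeumann_iff hS hN hsing hz h2 h3,
    isNeumann_iff hS.swap hN.swap hsing.swap hz k2 k3⟩

end IntegralSystem

/-! ### The singular continuation of a regular system -/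

theorem mem_interval_top {x : ℝ} : x ∈ interval ⊤ ↔ 0 ≤ x :=
  ⟨fun h => h.1, fun h => ⟨h, EReal.coe_lt_top x⟩⟩

theorem coe_toReal_of_pos {b : EReal} (hb : 0 < b) (hb' : b < ⊤) : (b.toReal : EReal) = b :=
  EReal.coe_toReal hb'.ne (EReal.bot_lt_zero.trans hb).ne'

theorem interval_eq_Ico {b : EReal} (hb : 0 < b) (hb' : b < ⊤) : interval b = Ico 0 b.toReal := by
  ext x
  refine and_congr Iff.rfl ?_
  rw [← EReal.coe_lt_coe_iff, coe_toReal_of_pos hb hb']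

namespace DistFun

variable {b : EReal} (R : DistFun b) (hb : 0 < b) (hR : R.Bounded) {k : ℝ} (hk : 0 ≤ k)

theorem extend_of_mem {x : ℝ} (hx : x ∈ interval b) : R.extend hb hR k hk x = R x := if_pos hx.2

theorem extend_of_le (hb' : b < ⊤) {x : ℝ} (hx : b.toReal ≤ x) :
    R.extend hb hR k hk x = R.endValue + k * (x - b.toReal) := by
  refine if_neg (not_lt.2 ?_)
  rw [← coe_toReal_of_pos hb hb']
  exact EReal.coe_le_coe_iff.2 hx

theorem restrict_extend_measure {x : ℝ} (hx : x ∈ interval b) :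
    (R.extend hb hR k hk).measure.restrict (Ico 0 x) = R.measure.restrict (Ico 0 x) :=
  (R.extend hb hR k hk).restrict_measure_congr R (mem_interval_top.2 hx.1) hx fun _ ht =>
    R.extend_of_mem hb hR hk (mem_interval_of_mem_Icc hx ht)

theorem extend_measure_singleton {x : ℝ} (hx : x ∈ interval b) :
    (R.extend hb hR k hk).measure {x} = R.measure {x} := by
  obtain ⟨y, hy, hxy⟩ := exists_gt_mem_interval hx
  have hsub : {x} ⊆ Ico 0 y := singleton_subset_iff.2 ⟨hx.1, hxy⟩
  rw [← Measure.restrict_eq_self _ hsub, R.restrict_extend_measure hb hR hk hy,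
    Measure.restrict_eq_self _ hsub]

end DistFun

namespace IntegralSystem

variable {S : IntegralSystem}

theorem continuation_noCommonAtoms (h : S.Regular) (hS : S.NoCommonAtoms) (hb : S.b < ⊤) :
    (S.continuation h).NoCommonAtoms := by
  intro t
  by_cases ht : t ∈ interval S.b
  · exact (hS t).imp (fun h' => (S.R₁.extend_measure_singleton S.b_pos h.1 le_rfl ht).trans h')
      (fun h' => (S.R₂.extend_measure_singleton S.b_pos h.2 zero_le_one ht).trans h')
  -- Off [0, b) the continued R₁ has no mass; this includes the point b, since the continuation is
  -- constant on [b, ∞).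
  left
  rcases lt_or_ge t 0 with h0 | h0
  · refine measure_mono_null (singleton_subset_iff.2 fun h' => ?_)
      (S.continuation h).R₁.measure_compl
    exact h0.not_ge h'.1
  · have hle : S.b.toReal ≤ t := by
      by_contra hlt
      exact ht (by rw [interval_eq_Ico S.b_pos hb]; exact ⟨h0, not_le.1 hlt⟩)
    have := (S.R₁.extend S.b_pos h.1 0 le_rfl).measure_singleton_le (mem_interval_top.2 h0)
      (mem_interval_top.2 (h0.trans (lt_add_one t).le)) (lt_add_one t)
    rw [S.R₁.extend_of_le _ _ _ hb hle,
      S.R₁.extend_of_le _ _ _ hb (hle.trans (lt_add_one t).le)] at this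
    refine le_antisymm (this.trans_eq ?_) zero_le
    simp

theorem continuation_nondegenerate (h : S.Regular) (hN : S.Nondegenerate) :
    (S.continuation h).Nondegenerate := by
  obtain ⟨x, hx, h1, h2⟩ := hN
  refine ⟨x, mem_interval_top.2 hx.1, ?_, ?_⟩
  · exact (S.R₁.extend_of_mem S.b_pos h.1 le_rfl hx).symm ▸ h1
  · exact (S.R₂.extend_of_mem S.b_pos h.2 zero_le_one hx).symm ▸ h2

theorem continuation_singular (h : S.Regular) (hb : S.b < ⊤) : (S.continuation h).Singular := by
  rintro ⟨-, C, hC⟩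
  have hpos : 0 ≤ S.b.toReal := EReal.toReal_nonneg S.b_pos.le
  set x := S.b.toReal + (|C - S.R₂.endValue| + 1) with hx
  have h0 := abs_nonneg (C - S.R₂.endValue)
  have h1 : (S.continuation h).R₂ x ≤ C := hC ⟨x, mem_interval_top.2 (by linarith), rfl⟩
  have h2 : (S.continuation h).R₂ x = S.R₂.endValue + 1 * (x - S.b.toReal) :=
    S.R₂.extend_of_le S.b_pos h.2 zero_le_one hb (by linarith)
  have h3 := le_abs_self (C - S.R₂.endValue)
  linarith

theorem IsSolution.of_continuation (h : S.Regular) {z : ℂ} {u : ℝ → Fin 2 → ℂ}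
    (hu : (S.continuation h).IsSolution z u) : S.IsSolution z u := by
  intro x hx
  have := hu x (mem_interval_top.2 hx.1)
  have e1 : (S.continuation h).R₁.measure.restrict (Ico 0 x) = S.R₁.measure.restrict (Ico 0 x) :=
    S.R₁.restrict_extend_measure S.b_pos h.1 le_rfl hx
  have e2 : (S.continuation h).R₂.measure.restrict (Ico 0 x) = S.R₂.measure.restrict (Ico 0 x) :=
    S.R₂.restrict_extend_measure S.b_pos h.2 zero_le_one hx
  unfold IntegrableOn at this ⊢
  rwa [e1, e2] at this

theorem continuation_U (h : S.Regular) (z : ℂ) : EqOn ((S.continuation h).U z) (S.U z)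
    (interval S.b) := by
  rw [← isFundamentalMatrix_iff]
  obtain ⟨h0, h1⟩ := (S.continuation h).isFundamentalMatrix_U z
  exact ⟨h0, fun j => (h1 j).of_continuation h⟩

/-- The first component changes only through dR₁, which vanishes on [b, x). -/
theorem continuation_fst_const (h : S.Regular) (hb : S.b < ⊤) {z : ℂ} {u v : ℝ → ℂ} {x : ℝ}
    (hx : S.b.toReal ≤ x) (hu : SolvesOn (S.continuation h).R₁.measure
      (S.continuation h).R₂.measure z u v x) : u x = u S.b.toReal := by
  have hpos : 0 ≤ S.b.toReal := EReal.toReal_nonneg S.b_pos.le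
  rw [hu.fst_eq x ⟨hpos.trans hx, le_rfl⟩, hu.fst_eq _ ⟨hpos, hx⟩]
  congr 1
  have hnull : (S.continuation h).R₁.measure (Ico S.b.toReal x) = 0 := by
    refine ((S.R₁.extend S.b_pos h.1 0 le_rfl).measure_Ico_of_le (mem_interval_top.2 hpos)
      (mem_interval_top.2 (hpos.trans hx)) hx).trans ?_
    rw [S.R₁.extend_of_le _ _ _ hb hx, S.R₁.extend_of_le _ _ _ hb le_rfl]
    simp
  refine setIntegral_congr_set ?_
  rw [← Ico_union_Ico_eq_Ico hpos hx]
  exact union_ae_eq_left_of_ae_eq_empty (ae_eq_empty.2 hnull)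

theorem tendsto_fst_endFilter (h : S.Regular) (hb : S.b < ⊤) {z : ℂ} {u v : ℝ → ℂ}
    (hu : SolvesOn (S.continuation h).R₁.measure (S.continuation h).R₂.measure z u v S.b.toReal) :
    Tendsto u (endFilter S.b) (𝓝 (u S.b.toReal)) := by
  have hpos : 0 ≤ S.b.toReal := EReal.toReal_nonneg S.b_pos.le
  have hI := interval_eq_Ico S.b_pos hb
  have := (tendsto_integral_endFilter S.b_pos (hI ▸ hu.integrable_snd)).const_add (u 0)
  rw [hI, ← hu.fst_eq _ ⟨hpos, le_rfl⟩] at this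
  refine this.congr' ?_
  filter_upwards [eventually_mem_interval S.b_pos] with x hx
  rw [hI] at hx
  exact (hu.fst_eq x (Ico_subset_Icc_self hx)).symm

theorem dual_of_regular (h : S.Regular) : S.dual = (S.continuation h).swap := dif_pos h

theorem dual_of_singular (h : S.Singular) : S.dual = S.swap := dif_neg h

/-- The boundary values of a regular system and the Weyl coefficients of its continuation. -/
theorem Regular.exists_boundary_values (h : S.Regular) (hS : S.NoCommonAtoms)
    (hN : S.Nondegenerate) (hb : S.b < ⊤) {z : ℂ} (hz : ¬ ∃ r : ℝ, 0 ≤ r ∧ z = r) :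
    ∃ c s : ℂ, c ≠ 0 ∧ s ≠ 0 ∧ Tendsto (S.c₁ z) (endFilter S.b) (𝓝 c) ∧
      Tendsto (S.s₁ z) (endFilter S.b) (𝓝 s) ∧
      S.dual.s₂ z S.b.toReal = c ∧ S.dual.c₂ z S.b.toReal = -z * s ∧
      S.dual.IsPrincipal z (-1 / (z * (s / c))) ∧
      ∀ w, S.dual.IsNeumann z w ↔ w = -1 / (z * (s / c)) := by
  set T := S.continuation h with hT
  have hTS := continuation_noCommonAtoms h hS hb
  have hTN := continuation_nondegenerate h hN
  have hTsing := continuation_singular h hb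
  have hpos : 0 ≤ S.b.toReal := EReal.toReal_nonneg S.b_pos.le
  have hβ : S.b.toReal ∈ interval T.b := mem_interval_top.2 hpos
  have hz0 := ne_zero_of_not_nonneg hz
  -- Both columns have positive energy at b, as R₁ and R₂ are already positive at some earlier
  -- point; so no component vanishes there.
  have hc0 : T.c₁ z S.b.toReal ≠ 0 ∧ T.s₁ z S.b.toReal ≠ 0 := by
    obtain ⟨x, hx, h1, h2⟩ := hN
    have hxb : x ≤ S.b.toReal := by
      rw [interval_eq_Ico S.b_pos hb] at hx
      exact hx.2.le
    have e1 : T.R₁ x = S.R₁ x := S.R₁.extend_of_mem S.b_pos h.1 le_rfl hx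
    have e2 : T.R₂ x = S.R₂ x := S.R₂.extend_of_mem S.b_pos h.2 zero_le_one hx
    have hx' : x ∈ interval T.b := mem_interval_top.2 hx.1
    exact ⟨(ne_zero_of_energy_pos (hTS.energy_c_pos hz hβ
        ((e2 ▸ h2).trans_le (T.R₂.mono hx' hβ hxb)))).1,
      (ne_zero_of_energy_pos (hTS.energy_s_pos hz hβ
        ((e1 ▸ h1).trans_le (T.R₁.mono hx' hβ hxb)))).1⟩
  have hU : ∀ᶠ x in endFilter S.b, T.U z x = S.U z x := by
    filter_upwards [eventually_mem_interval S.b_pos] with x hx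
    exact continuation_U h z hx
  obtain ⟨q, -, h1, h2, -, h4⟩ := exists_weyl_coefficient hTS hTN hTsing hz
  have hbot := endFilter_neBot T.b_pos
  -- Past b the quotient s₁/c₁ is constant, so its limit is its value at b.
  have hq : q = T.s₁ z S.b.toReal / T.c₁ z S.b.toReal := by
    refine tendsto_nhds_unique h1 (tendsto_const_nhds.congr' ?_)
    filter_upwards [eventually_ge_endFilter T.b_pos hβ] with x hx
    have hx' : x ∈ interval T.b := mem_interval_top.2 (hpos.trans hx)
    rw [continuation_fst_const h hb hx (T.solvesOn_c z hx'),
      continuation_fst_const h hb hx (T.solvesOn_s z hx')]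
  subst hq
  refine ⟨T.c₁ z S.b.toReal, T.s₁ z S.b.toReal, hc0.1, hc0.2, ?_, ?_, ?_, ?_, ?_, ?_⟩
  · refine (tendsto_fst_endFilter h hb (T.solvesOn_c z hβ)).congr' ?_
    filter_upwards [hU] with x hx
    simp only [c₁, hx]
  · refine (tendsto_fst_endFilter h hb (T.solvesOn_s z hβ)).congr' ?_
    filter_upwards [hU] with x hx
    simp only [s₁, hx]
  · rw [dual_of_regular h, T.swap_s₂ hz0 hβ]
  · rw [dual_of_regular h, T.swap_c₂ hz0 hβ]
  · rw [dual_of_regular h]; exact h2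
  · rw [dual_of_regular h]; exact h4

end IntegralSystem

end IntSys

end

/-! ### The duality theorem -/

theorem mainTheorem1 (S : IntSys.IntegralSystem)
    (hdisc : S.NoCommonDiscontinuity) (hdef : S.Definite)
    (hb : S.Regular → S.b < ⊤) :
    -- (i) the fundamental matrices (which exist and are unique)
    ((∀ z V, S.IsFundamentalMatrix z V ↔ Set.EqOn V (S.U z) (IntSys.interval S.b)) ∧
      (∀ z V, S.dual.IsFundamentalMatrix z V ↔
        Set.EqOn V (S.dual.U z) (IntSys.interval S.dual.b)) ∧
      (∀ z, z ≠ 0 → ∀ x ∈ IntSys.interval S.b,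
        S.dual.U z x = (IntSys.D z)⁻¹ * S.U z x * IntSys.D z) ∧
      (∀ h : S.Regular, ∀ z, z ≠ 0 → ∀ x, 0 ≤ x →
        S.dual.U z x = (IntSys.D z)⁻¹ * (S.continuation h).U z x * IntSys.D z)) ∧
    -- (ii) the singular case
    (S.Singular → ∀ z : ℂ, z.im ≠ 0 → ∃ mN : ℂ, mN ≠ 0 ∧
      (∀ w, S.IsNeumann z w ↔ w = mN) ∧
      (∀ w, S.dual.IsNeumann z w ↔ w = -1 / (z * mN))) ∧
    -- (iii) the regular case
    (S.Regular → ∀ z : ℂ, (¬ ∃ r : ℝ, 0 ≤ r ∧ z = r) → ∃ c₁b s₁b mND : ℂ,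
      Filter.Tendsto (S.c₁ z) (IntSys.endFilter S.b) (nhds c₁b) ∧
      Filter.Tendsto (S.s₁ z) (IntSys.endFilter S.b) (nhds s₁b) ∧
      s₁b ≠ 0 ∧ S.dual.c₂ z S.b.toReal ≠ 0 ∧ mND ≠ 0 ∧
      (∀ w, S.IsNeumannD z w ↔ w = mND) ∧
      (∀ w, S.dual.IsNeumann z w ↔ w = S.dual.s₂ z S.b.toReal / S.dual.c₂ z S.b.toReal) ∧
      S.dual.s₂ z S.b.toReal / S.dual.c₂ z S.b.toReal = -c₁b / (z * s₁b) ∧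
      -c₁b / (z * s₁b) = -1 / (z * mND)) ∧
    -- (iv) the principal Titchmarsh–Weyl coefficients
    (∀ z : ℂ, (¬ ∃ r : ℝ, 0 ≤ r ∧ z = r) → ∃ q : ℂ, q ≠ 0 ∧
      S.IsPrincipal z q ∧ S.dual.IsPrincipal z (-1 / (z * q))) := by
  have hS := hdisc.noCommonAtoms
  have hN := hdef.nondegenerate
  refine ⟨⟨S.isFundamentalMatrix_iff, S.dual.isFundamentalMatrix_iff, ?_, ?_⟩, ?_, ?_, ?_⟩
  · intro z hz x hx
    by_cases h : S.Regular
    · rw [IntSys.IntegralSystem.dual_of_regular h,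
        (S.continuation h).swap_U hz (IntSys.mem_interval_top.2 hx.1),
        IntSys.IntegralSystem.continuation_U h z hx]
    · rw [IntSys.IntegralSystem.dual_of_singular h, S.swap_U hz hx]
  · intro h z hz x hx
    rw [IntSys.IntegralSystem.dual_of_regular h,
      (S.continuation h).swap_U hz (IntSys.mem_interval_top.2 hx)]
  · intro hsing z hz
    obtain ⟨q, hq0, -, -, h1, h2⟩ := IntSys.IntegralSystem.exists_weyl_coefficient hS hN hsing
      (IntSys.not_nonneg_of_im_ne_zero hz)
    rw [IntSys.IntegralSystem.dual_of_singular hsing]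
    exact ⟨q, hq0, h1, h2⟩
  · intro h z hz
    have hz0 := IntSys.ne_zero_of_not_nonneg hz
    obtain ⟨c, s, hc, hs, hlc, hls, hs2, hc2, -, hm⟩ :=
      h.exists_boundary_values hS hN (hb h) hz
    have hbot := IntSys.endFilter_neBot S.b_pos
    refine ⟨c, s, s / c, hlc, hls, hs, ?_, div_ne_zero hs hc, fun w => ?_, fun w => ?_, ?_, ?_⟩
    · rw [hc2]
      exact mul_ne_zero (neg_ne_zero.2 hz0) hs
    · have hlim : Tendsto (fun x => S.s₁ z x - w * S.c₁ z x) (IntSys.endFilter S.b)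
          (𝓝 (s - w * c)) := hls.sub (hlc.const_mul w)
      have : S.IsNeumannD z w ↔ s - w * c = 0 :=
        ⟨fun h => tendsto_nhds_unique hlim h, fun h => by
          unfold IntSys.IntegralSystem.IsNeumannD
          rwa [h] at hlim⟩
      rw [this, eq_div_iff hc, sub_eq_zero, eq_comm]
    · rw [hm w, hs2, hc2]
      have : -1 / (z * (s / c)) = c / (-z * s) := by field_simp
      rw [this]
    · rw [hs2, hc2, neg_mul, div_neg, neg_div]
    · field_simp
  · intro z hz
    by_cases h : S.Regular
    · obtain ⟨c, s, hc, hs, hlc, hls, -, -, hp, -⟩ :=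
        h.exists_boundary_values hS hN (hb h) hz
      exact ⟨s / c, div_ne_zero hs hc, hls.div hlc hc, hp⟩
    · obtain ⟨q, hq0, h1, h2, -, -⟩ := IntSys.IntegralSystem.exists_weyl_coefficient hS hN h hz
      rw [IntSys.IntegralSystem.dual_of_singular h]
      exact ⟨q, hq0, h1, h2⟩
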